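/- **Setting.** Let $G$ be a discrete group. A complex algebra $A$ (not necessarily unital) is quadratik if each of its elements is a finite sum of products. Let $\Lambda^G$ be the category of all quadratik complex $G$-algebras (with carriers in a fixed universe) and $G$-equivariant algebra homomorphisms. A functional module over $(A,\alpha)\in\Lambda^G$ is a $G$-equivariant right $A$-module $(\mathcal E,S)$ with a $G$-invariant linear space $\Theta_A(\mathcal E)$ of $A$-linear maps $\mathcal E\to A$ that is closed under left multiplication by $A$. The algebra $\mathcal K_A(\mathcal E)$, with the adjoint action, is the linear span of the operators $\eta\mapsto\xi\,\phi(\eta)$ ($\xi\in\mathcal E$, $\phi\in\Theta_A(\mathcal E)$), and $\mathcal E$ is cofull if the elements $\xi\,\phi(\eta)$ span it. The direct sum $\mathcal E\oplus A$ carries the functionals $\Theta_A(\mathcal E)\oplus A$, with $A$ acting on $A$ by left multiplication. A corner embedding is an equivariant homomorphism $e:A\to J\cong\mathcal K_A(\mathcal E\oplus A)$, $e(a)(\xi\oplus b)=0\oplus ab$, with $\mathcal E\oplus A$ cofull. $GK^G$ is the additive category with the objects of $\Lambda^G$ that is generated by the equivariant homomorphisms, a morphism $e^{-1}:J\to A$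 for each corner embedding $e:A\to J$, and a morphism $\Delta_s:M\to J$ for each split exact sequence $0\to J\xrightarrow{i}M\xrightarrow{f}A\to0$ with split $s$ in $\Lambda^G$. Its relations are the laws of an additive category and: composition and identities of homomorphisms are those of $\Lambda^G$; $e^{-1}$ is inverse to $e$; $1_M=\Delta_s i+fs$ and $1_J=i\Delta_s$; and $\varphi_0=\varphi_1$ for each equivariant homomorphism $\varphi:A\to B[0,1]=B\otimes C([0,1])$ with evaluations $\varphi_0,\varphi_1$ at $0,1$. Products are written from left to right. A level-one morphism $s_+\nabla_{s_-}$ from $(A,\alpha)$ to $B$ is given by * an algebra $(X,\gamma_-)\in\Lambda^G$, a two-sided $G$-invariant ideal $J$ of it with $J\in\Lambda^G$, and a corner embedding $e:B\to J$; * an equivariant homomorphism $s_-:A\to (X,\gamma_-)$ and a homomorphism $s_+:A\to X$ with $s_+(a)-s_-(a)\in J$ for all $a$. Put $M=X\,\square_{s_-}A:=J\oplus0+(s_-\oplus\mathrm{id})(A)\subseteq X\oplus A$; let $M_-$ be $M$ with the action $\gamma_-\oplus\alpha$, and let $f:M\to A$ be the projection; * a second $G$-action on $M$, giving a $G$-algebra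 $M_+$, for which $s_+\oplus\mathrm{id}:A\to M_+$ and $f:M_+\to A$ are equivariant; * a $G$-action $\delta$ on $M_2(M)$ for which the embeddings $f_1:M_-\to M_2(M)$ and $f_2:M_+\to M_2(M)$ into the top left and the bottom right corner are equivariant corner embeddings. As a morphism of $GK^G$ it is $s_+\nabla_{s_-}:=(s_+\oplus\mathrm{id})\cdot f_2\cdot f_1^{-1}\cdot\Delta_{s_-\oplus\mathrm{id}}\cdot e^{-1}\in GK^G(A,B)$. The set of all these morphisms is $L_1GK^G(A,B)$. **Proposition 2.2.** Let $s_+\nabla_{s_-}\in L_1GK^G(\mathbb C,B)$ be given by data as above ($G$ acts trivially on $\mathbb C$). Let $X^+$ be the unitization of $X$, and put $p:=s_-(1)$, $p^\perp:=1_{X^+}-p$, $q(\lambda):=\lambda p^\perp$ and, for $t\in[0,\pi/2]$, $$U_t:=\begin{pmatrix}\cos(t)\,p&\sin(t)\,p\\-\sin(t)\,p&\cos(t)\,p\end{pmatrix}+\begin{pmatrix}p^\perp&0\\0&p^\perp\end{pmatrix}\in M_2(X^+).$$ Then $U_{\pi/2}$ is invertible and, for $t_\pm(\lambda):=U_{\pi/2}\,\bigl(s_\pm(\lambda)\oplus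 q(\lambda)\bigr)\,U_{\pi/2}^{-1}$, $$t_-(\lambda)=\lambda\,(0\oplus1_{X^+}),\qquad t_+=\begin{pmatrix}p^\perp s_+p^\perp&-p^\perp s_+p\\-p\,s_+p^\perp&p\,s_+p+q\end{pmatrix}.$$ Moreover there is a level-one morphism $t_+\nabla_{t_-}$ from $\mathbb C$ to $B$ given by these two homomorphisms $t_\pm:\mathbb C\to M_2(X^+)$, the ideal $M_2(J)\subseteq M_2(X^+)$ (both with the entrywise action induced by $\gamma_-$), the corner embedding $b\mapsto e(b)\oplus0$ of $B$ into $M_2(J)$, and suitable actions on $M_2(X^+)\,\square_{t_-}\mathbb C$ and on its $2\times2$ matrices, such that $$s_+\nabla_{s_-}=t_+\nabla_{t_-}\quad\text{in }GK^G(\mathbb C,B).$$ The same holds with $M_2(X^+)$ replaced by $M_2(J^+)\subseteq M_2(X^+)$, which contains the ranges of $t_\pm$. -/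

import Mathlib

open scoped TensorProduct

universe v u

noncomputable section

namespace GKTheory

/-! ### Algebras with an action of a discrete group -/

/-- An action of the (discrete) group `G` on a complex algebra by algebra endomorphisms; by the
group laws each of them is an automorphism, so this is a homomorphism `G → Aut(A)`. -/
structure GAction (G : Type v) [Group G] (A : Type u) [NonUnitalRing A] [Module ℂ A] where
  toFun : G → A →ₙₐ[ℂ] A
  one_apply : ∀ a, toFun 1 a = a
  mul_apply : ∀ g h a, toFun (g * h) a = toFun g (toFun h a)

/-- Every element is a finite sum of products (scalars can be absorbed into a factor). -/
def IsQuadratik (A : Type u) [NonUnitalRing A] [Module ℂ A] : Prop :=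
  ∀ a : A, a ∈ Submodule.span ℂ {c : A | ∃ x y : A, x * y = c}

/-- Quadratik `G`-algebras over `ℂ`, not necessarily unital, with carrier in a fixed universe. -/
structure GAlg (G : Type v) [Group G] where
  carrier : Type u
  [ring : NonUnitalRing carrier]
  [module : Module ℂ carrier]
  [tower : IsScalarTower ℂ carrier carrier]
  [comm : SMulCommClass ℂ carrier carrier]
  act : GAction G carrier
  quadratik : IsQuadratik carrier

attribute [instance] GAlg.ring GAlg.module GAlg.tower GAlg.comm

variable {G : Type v} [Group G]

/-- `G`-equivariant algebra homomorphisms. -/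
structure GHom (A B : GAlg.{v, u} G) where
  toHom : A.carrier →ₙₐ[ℂ] B.carrier
  equivariant : ∀ g a, toHom (A.act.toFun g a) = B.act.toFun g (toHom a)

/-- The identity homomorphism. -/
def GHom.id (A : GAlg.{v, u} G) : GHom A A where
  toHom := NonUnitalAlgHom.id ℂ A.carrier
  equivariant _ _ := rfl

/-- `φ` followed by `ψ`. -/
def GHom.trans {A B C : GAlg.{v, u} G} (φ : GHom A B) (ψ : GHom B C) : GHom A C where
  toHom := ψ.toHom.comp φ.toHom
  equivariant g a := by simp [φ.equivariant, ψ.equivariant]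

/-! ### Elementary constructions -/

theorem IsQuadratik.of_unital (A : Type u) [Ring A] [Module ℂ A] : IsQuadratik A :=
  fun a => Submodule.subset_span ⟨a, 1, mul_one a⟩

/-- The field `ℂ` with the trivial action (lifted to the universe of the algebras). -/
abbrev scalars (G : Type v) [Group G] : GAlg.{v, u} G where
  carrier := ULift.{u} ℂ
  tower := ⟨fun a b c => by ext; simp⟩
  comm := ⟨fun a b c => by ext; simp⟩
  act :=
    { toFun := fun _ => NonUnitalAlgHom.id ℂ _
      one_apply := fun _ => rfl
      mul_apply := fun _ _ _ => rfl }
  quadratik := IsQuadratik.of_unital _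

/-- The canonical extension `φ⁺ : A⁺ → B⁺` of a homomorphism to the unitizations. -/
def unitizationMap {A B : Type u} [NonUnitalRing A] [Module ℂ A] [IsScalarTower ℂ A A]
    [SMulCommClass ℂ A A] [NonUnitalRing B] [Module ℂ B] [IsScalarTower ℂ B B]
    [SMulCommClass ℂ B B] (φ : A →ₙₐ[ℂ] B) : Unitization ℂ A →ₙₐ[ℂ] Unitization ℂ B :=
  (Unitization.lift ((Unitization.inrNonUnitalAlgHom ℂ B).comp φ) : _ →ₐ[ℂ] _)

theorem unitizationMap_apply {A B : Type u} [NonUnitalRing A] [Module ℂ A] [IsScalarTower ℂ A A]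
    [SMulCommClass ℂ A A] [NonUnitalRing B] [Module ℂ B] [IsScalarTower ℂ B B]
    [SMulCommClass ℂ B B] (φ : A →ₙₐ[ℂ] B) (x : Unitization ℂ A) :
    unitizationMap φ x = Unitization.inl x.fst + Unitization.inr (φ x.snd) := by
  rfl

/-- The unitization `A⁺` with the canonically extended action. -/
abbrev GAlg.plus (A : GAlg.{v, u} G) : GAlg.{v, u} G where
  carrier := Unitization ℂ A.carrier
  act :=
    { toFun := fun g => unitizationMap (A.act.toFun g)
      one_apply := fun x => by
        rw [unitizationMap_apply, A.act.one_apply, Unitization.inl_fst_add_inr_snd_eq]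
      mul_apply := fun g h x => by
        simp [unitizationMap_apply, A.act.mul_apply] }
  quadratik := IsQuadratik.of_unital _

/-- Entrywise application of a homomorphism to `2 × 2` matrices. -/
def mat2Map {A B : Type u} [NonUnitalRing A] [Module ℂ A] [NonUnitalRing B] [Module ℂ B]
    (φ : A →ₙₐ[ℂ] B) : Matrix (Fin 2) (Fin 2) A →ₙₐ[ℂ] Matrix (Fin 2) (Fin 2) B where
  toFun m := m.map φ
  map_smul' c m := by ext; simp
  map_zero' := by ext; simp
  map_add' m n := by ext; simp
  map_mul' m n := by ext; simp [Matrix.mul_apply]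

theorem IsQuadratik.mat2 {A : Type u} [NonUnitalRing A] [Module ℂ A] (h : IsQuadratik A) :
    IsQuadratik (Matrix (Fin 2) (Fin 2) A) := by
  intro m
  have key : ∀ (i j : Fin 2) (a : A), Matrix.single i j a ∈
      Submodule.span ℂ {c : Matrix (Fin 2) (Fin 2) A | ∃ x y, x * y = c} := by
    intro i j a
    have ha := h a
    induction ha using Submodule.span_induction with
    | mem c hc =>
      obtain ⟨x, y, rfl⟩ := hc
      exact Submodule.subset_span ⟨Matrix.single i i x, Matrix.single i j y, by simp⟩
    | zero => simp
    | add x y _ _ hx hy => rw [Matrix.single_add]; exact Submodule.add_mem _ hx hy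
    | smul c x _ hx => rw [← Matrix.smul_single]; exact Submodule.smul_mem _ c hx
  rw [Matrix.matrix_eq_sum_single m]
  exact Submodule.sum_mem _ fun i _ => Submodule.sum_mem _ fun j _ => key i j _

/-- The algebra of `2 × 2` matrices over `A`, with a given action. -/
abbrev GAlg.mat2With (A : GAlg.{v, u} G) (δ : GAction G (Matrix (Fin 2) (Fin 2) A.carrier)) :
    GAlg.{v, u} G where
  carrier := Matrix (Fin 2) (Fin 2) A.carrier
  act := δ
  quadratik := A.quadratik.mat2

/-- `M₂(A)` with the entrywise action. -/
abbrev GAlg.mat2 (A : GAlg.{v, u} G) : GAlg.{v, u} G :=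
  A.mat2With
    { toFun := fun g => mat2Map (A.act.toFun g)
      one_apply := fun m => by ext; simp [mat2Map, A.act.one_apply]
      mul_apply := fun g h m => by ext; simp [mat2Map, A.act.mul_apply] }

/-- The algebra `C([0,1])` of continuous complex functions on the unit interval. -/
def IntervalFun : Type := C(unitInterval, ℂ)

instance : CommRing IntervalFun := inferInstanceAs (CommRing C(unitInterval, ℂ))

instance : Algebra ℂ IntervalFun := inferInstanceAs (Algebra ℂ C(unitInterval, ℂ))

/-- Evaluation of a function at the point `t`. -/
def IntervalFun.eval (t : unitInterval) : IntervalFun →ₐ[ℂ] ℂ where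
  toFun f := (show C(unitInterval, ℂ) from f) t
  map_one' := rfl
  map_mul' _ _ := rfl
  map_zero' := rfl
  map_add' _ _ := rfl
  commutes' _ := rfl

/-- The endomorphism `φ ⊗ id` of `A ⊗ R`. -/
def tensorMap (R : Type) [CommRing R] [Algebra ℂ R] {A : Type u} [NonUnitalRing A] [Module ℂ A]
    [IsScalarTower ℂ A A] [SMulCommClass ℂ A A] (φ : A →ₙₐ[ℂ] A) : A ⊗[ℂ] R →ₙₐ[ℂ] A ⊗[ℂ] R where
  toFun := LinearMap.rTensor R (φ : A →ₗ[ℂ] A)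
  map_smul' c x := by simp
  map_zero' := by simp
  map_add' x y := by simp
  map_mul' x y := by
    induction x using TensorProduct.induction_on with
    | zero => simp
    | add x x' hx hx' => rw [add_mul, map_add, map_add, add_mul, hx, hx']
    | tmul a f =>
      induction y using TensorProduct.induction_on with
      | zero => simp
      | add y y' hy hy' => rw [mul_add, map_add, map_add, mul_add, hy, hy']
      | tmul b g => simp

theorem IsQuadratik.tensor (R : Type) [CommRing R] [Algebra ℂ R] {A : Type u} [NonUnitalRing A]
    [Module ℂ A] [IsScalarTower ℂ A A] [SMulCommClass ℂ A A] (h : IsQuadratik A) :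
    IsQuadratik (A ⊗[ℂ] R) := by
  intro z
  induction z using TensorProduct.induction_on with
  | zero => exact Submodule.zero_mem _
  | add x y hx hy => exact Submodule.add_mem _ hx hy
  | tmul a f =>
    have ha := h a
    induction ha using Submodule.span_induction with
    | mem c hc =>
      obtain ⟨x, y, rfl⟩ := hc
      exact Submodule.subset_span ⟨x ⊗ₜ f, y ⊗ₜ 1, by simp⟩
    | zero => simp
    | add x y _ _ hx hy => rw [TensorProduct.add_tmul]; exact Submodule.add_mem _ hx hy
    | smul c x _ hx => rw [← TensorProduct.smul_tmul']; exact Submodule.smul_mem _ c hx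

/-- The path algebra `A[0,1] = A ⊗ C([0,1])`, with trivial action on the second factor. -/
abbrev GAlg.path (A : GAlg.{v, u} G) : GAlg.{v, u} G where
  carrier := A.carrier ⊗[ℂ] IntervalFun
  act :=
    { toFun := fun g => tensorMap IntervalFun (A.act.toFun g)
      one_apply := fun x => by
        have h : ((A.act.toFun 1 : A.carrier →ₙₐ[ℂ] A.carrier) : A.carrier →ₗ[ℂ] A.carrier)
            = LinearMap.id := LinearMap.ext fun a => A.act.one_apply a
        change LinearMap.rTensor _ _ x = x
        rw [h, LinearMap.rTensor_id, LinearMap.id_apply]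
      mul_apply := fun g k x => by
        have h : ((A.act.toFun (g * k) : A.carrier →ₙₐ[ℂ] A.carrier) :
              A.carrier →ₗ[ℂ] A.carrier)
            = ((A.act.toFun g : A.carrier →ₙₐ[ℂ] A.carrier) : A.carrier →ₗ[ℂ] A.carrier) ∘ₗ
              ((A.act.toFun k : A.carrier →ₙₐ[ℂ] A.carrier) : A.carrier →ₗ[ℂ] A.carrier) :=
          LinearMap.ext fun a => A.act.mul_apply g k a
        change LinearMap.rTensor _ _ x = LinearMap.rTensor _ _ (LinearMap.rTensor _ _ x)
        rw [h, LinearMap.rTensor_comp, LinearMap.comp_apply] }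
  quadratik := A.quadratik.tensor IntervalFun

/-- Evaluation `A[0,1] → A` at the time `t`, that is, `a ⊗ f ↦ f(t) a`. -/
def evalAt (A : GAlg.{v, u} G) (t : unitInterval) :
    A.carrier ⊗[ℂ] IntervalFun →ₗ[ℂ] A.carrier :=
  (TensorProduct.rid ℂ A.carrier).toLinearMap ∘ₗ
    LinearMap.lTensor A.carrier (IntervalFun.eval t).toLinearMap

/-! ### Functional modules, compact operators, corner embeddings -/

/-- A functional module over the `G`-algebra `A`: a `G`-equivariant right `A`-module `E` with a
distinguished `G`-invariant space `Θ_A(E)` of `A`-linear functionals `E → A`, closed under left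
multiplication by `A`. -/
structure FunctionalModule (A : GAlg.{v, u} G) where
  carrier : Type u
  [group : AddCommGroup carrier]
  [module : Module ℂ carrier]
  /-- the right multiplication `ξ · a` -/
  rsmul : carrier →ₗ[ℂ] A.carrier →ₗ[ℂ] carrier
  rsmul_mul : ∀ ξ a b, rsmul ξ (a * b) = rsmul (rsmul ξ a) b
  /-- the action `S` of `G` -/
  act : G → carrier →ₗ[ℂ] carrier
  act_one : ∀ ξ, act 1 ξ = ξ
  act_mul : ∀ g h ξ, act (g * h) ξ = act g (act h ξ)
  act_rsmul : ∀ g ξ a, act g (rsmul ξ a) = rsmul (act g ξ) (A.act.toFun g a)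
  /-- the functional space `Θ_A(E)` -/
  functionals : Submodule ℂ (carrier →ₗ[ℂ] A.carrier)
  functional_rsmul : ∀ φ ∈ functionals, ∀ ξ a, φ (rsmul ξ a) = φ ξ * a
  mul_functional : ∀ φ ∈ functionals, ∀ a, LinearMap.mulLeft ℂ a ∘ₗ φ ∈ functionals
  act_functional : ∀ φ ∈ functionals, ∀ g,
    (A.act.toFun g : A.carrier →ₗ[ℂ] A.carrier) ∘ₗ φ ∘ₗ act g⁻¹ ∈ functionals

attribute [instance] FunctionalModule.group FunctionalModule.module

namespace FunctionalModule

variable {A : GAlg.{v, u} G}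

/-- The direct sum `E ⊕ A`, with functionals `Θ_A(E) ⊕ A`, where `a ∈ A` is the functional
`b ↦ a b` on the summand `A`. -/
abbrev sumSelf (E : FunctionalModule A) : FunctionalModule A where
  carrier := E.carrier × A.carrier
  rsmul := LinearMap.mk₂ ℂ (fun ξ a => (E.rsmul ξ.1 a, ξ.2 * a))
    (fun ξ η a => by simp [add_mul]) (fun c ξ a => by simp [smul_mul_assoc])
    (fun ξ a b => by simp [mul_add]) (fun c ξ a => by simp [mul_smul_comm])
  rsmul_mul ξ a b := by simp [E.rsmul_mul, mul_assoc]
  act g := (E.act g).prodMap (A.act.toFun g : A.carrier →ₗ[ℂ] A.carrier)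
  act_one ξ := by ext <;> simp [E.act_one, A.act.one_apply]
  act_mul g h ξ := by ext <;> simp [E.act_mul, A.act.mul_apply]
  act_rsmul g ξ a := by ext <;> simp [E.act_rsmul]
  functionals :=
    { carrier := {ψ | ∃ φ ∈ E.functionals, ∃ a : A.carrier,
        ψ = φ ∘ₗ LinearMap.fst ℂ _ _ + LinearMap.mulLeft ℂ a ∘ₗ LinearMap.snd ℂ _ _}
      zero_mem' := ⟨0, E.functionals.zero_mem, 0, by ext <;> simp⟩
      add_mem' := by
        rintro _ _ ⟨φ, hφ, a, rfl⟩ ⟨φ', hφ', a', rfl⟩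
        exact ⟨φ + φ', E.functionals.add_mem hφ hφ', a + a', by ext <;> simp [add_mul]⟩
      smul_mem' := by
        rintro c _ ⟨φ, hφ, a, rfl⟩
        exact ⟨c • φ, E.functionals.smul_mem c hφ, c • a, by ext <;> simp [smul_mul_assoc]⟩ }
  functional_rsmul := by
    rintro _ ⟨φ, hφ, b, rfl⟩ ξ a
    simp [E.functional_rsmul φ hφ, add_mul, mul_assoc]
  mul_functional := by
    rintro _ ⟨φ, hφ, b, rfl⟩ a
    exact ⟨_, E.mul_functional φ hφ a, a * b, by ext <;> simp⟩
  act_functional := by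
    rintro _ ⟨φ, hφ, b, rfl⟩ g
    refine ⟨_, E.act_functional φ hφ g, A.act.toFun g b, ?_⟩
    ext x
    · simp
    · simp [← A.act.mul_apply, A.act.one_apply]

/-- The elementary operator `η ↦ ξ · φ(η)`. -/
def elementary (E : FunctionalModule A) (ξ : E.carrier) (φ : E.carrier →ₗ[ℂ] A.carrier) :
    Module.End ℂ E.carrier :=
  E.rsmul ξ ∘ₗ φ

/-- The compact operators `K_A(E)`: the linear span of the elementary operators. -/
def compacts (E : FunctionalModule A) : Submodule ℂ (Module.End ℂ E.carrier) :=
  Submodule.span ℂ {T | ∃ ξ, ∃ φ ∈ E.functionals, T = E.elementary ξ φ}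

/-- `E` is cofull: it is spanned by the elements `ξ · φ(η)`. -/
def IsCofull (E : FunctionalModule A) : Prop :=
  Submodule.span ℂ {ζ | ∃ ξ, ∃ φ ∈ E.functionals, ∃ η, ζ = E.rsmul ξ (φ η)} = ⊤

end FunctionalModule

/-- `e : A → J` is a corner embedding: for some functional module `E` with `E ⊕ A` cofull, `J` is
`K_A(E ⊕ A)` with the adjoint action (through an equivariant isomorphism `π`), and
`e(a)(ξ ⊕ b) = 0 ⊕ a b`. -/
def IsCornerEmbedding {A J : GAlg.{v, u} G} (e : GHom A J) : Prop :=
  ∃ E : FunctionalModule A, E.sumSelf.IsCofull ∧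
    ∃ π : J.carrier →ₙₐ[ℂ] Module.End ℂ E.sumSelf.carrier,
      Function.Injective π ∧
      Set.range π = (E.sumSelf.compacts : Set (Module.End ℂ E.sumSelf.carrier)) ∧
      (∀ g x, π (J.act.toFun g x) = E.sumSelf.act g ∘ₗ π x ∘ₗ E.sumSelf.act g⁻¹) ∧
      ∀ a ξ b, π (e.toHom a) (ξ, b) = (0, a * b)

/-! ### The category `GK^G` by generators and relations -/

/-- A split exact sequence `0 → J → M → A → 0` of `G`-algebras. -/
structure SplitExact (J M A : GAlg.{v, u} G) where
  i : GHom J M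
  f : GHom M A
  s : GHom A M
  i_injective : Function.Injective i.toHom
  exact : ∀ m, f.toHom m = 0 ↔ ∃ j, i.toHom j = m
  split : ∀ a, f.toHom (s.toHom a) = a

/-- The formal expressions built from the generators: the equivariant homomorphisms, the
synthetical inverses of the corner embeddings and the synthetical splits of the split exact
sequences. The product `x.comp y` is written from left to right. -/
inductive Word : GAlg.{v, u} G → GAlg.{v, u} G → Type (max (u + 1) v)
  | hom {A B : GAlg.{v, u} G} (φ : GHom A B) : Word A B
  | cornerInv {A J : GAlg.{v, u} G} (e : GHom A J) (he : IsCornerEmbedding e) : Word J A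
  | split {J M A : GAlg.{v, u} G} (S : SplitExact J M A) : Word M J
  | comp {A B C : GAlg.{v, u} G} (x : Word A B) (y : Word B C) : Word A C
  | plus {A B : GAlg.{v, u} G} (x y : Word A B) : Word A B
  | neg {A B : GAlg.{v, u} G} (x : Word A B) : Word A B
  | zero {A B : GAlg.{v, u} G} : Word A B

/-- The equivalence relation on the formal expressions generated by the laws of an additive
category and the defining relations of `GK^G`. -/
inductive Rel : ∀ {A B : GAlg.{v, u} G}, Word A B → Word A B → Prop
  | refl {A B : GAlg.{v, u} G} (x : Word A B) : Rel x x
  | symm {A B : GAlg.{v, u} G} {x y : Word A B} : Rel x y → Rel y x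
  | trans {A B : GAlg.{v, u} G} {x y z : Word A B} : Rel x y → Rel y z → Rel x z
  | comp_congr {A B C : GAlg.{v, u} G} {x x' : Word A B} {y y' : Word B C} :
      Rel x x' → Rel y y' → Rel (x.comp y) (x'.comp y')
  | plus_congr {A B : GAlg.{v, u} G} {x x' y y' : Word A B} :
      Rel x x' → Rel y y' → Rel (x.plus y) (x'.plus y')
  | neg_congr {A B : GAlg.{v, u} G} {x x' : Word A B} : Rel x x' → Rel x.neg x'.neg
  | comp_assoc {A B C D : GAlg.{v, u} G} (x : Word A B) (y : Word B C) (z : Word C D) :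
      Rel ((x.comp y).comp z) (x.comp (y.comp z))
  | plus_assoc {A B : GAlg.{v, u} G} (x y z : Word A B) :
      Rel ((x.plus y).plus z) (x.plus (y.plus z))
  | plus_comm {A B : GAlg.{v, u} G} (x y : Word A B) : Rel (x.plus y) (y.plus x)
  | zero_plus {A B : GAlg.{v, u} G} (x : Word A B) : Rel (Word.zero.plus x) x
  | neg_plus {A B : GAlg.{v, u} G} (x : Word A B) : Rel (x.neg.plus x) Word.zero
  | plus_comp {A B C : GAlg.{v, u} G} (x y : Word A B) (z : Word B C) :
      Rel ((x.plus y).comp z) ((x.comp z).plus (y.comp z))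
  | comp_plus {A B C : GAlg.{v, u} G} (x : Word A B) (y z : Word B C) :
      Rel (x.comp (y.plus z)) ((x.comp y).plus (x.comp z))
  | hom_comp {A B C : GAlg.{v, u} G} (φ : GHom A B) (ψ : GHom B C) :
      Rel ((Word.hom φ).comp (Word.hom ψ)) (Word.hom (φ.trans ψ))
  | id_comp {A B : GAlg.{v, u} G} (x : Word A B) : Rel ((Word.hom (GHom.id A)).comp x) x
  | comp_id {A B : GAlg.{v, u} G} (x : Word A B) : Rel (x.comp (Word.hom (GHom.id B))) x
  | corner_inv {A J : GAlg.{v, u} G} (e : GHom A J) (he : IsCornerEmbedding e) :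
      Rel ((Word.hom e).comp (Word.cornerInv e he)) (Word.hom (GHom.id A))
  | inv_corner {A J : GAlg.{v, u} G} (e : GHom A J) (he : IsCornerEmbedding e) :
      Rel ((Word.cornerInv e he).comp (Word.hom e)) (Word.hom (GHom.id J))
  | split_sum {J M A : GAlg.{v, u} G} (S : SplitExact J M A) :
      Rel (Word.hom (GHom.id M))
        (((Word.split S).comp (Word.hom S.i)).plus ((Word.hom S.f).comp (Word.hom S.s)))
  | incl_split {J M A : GAlg.{v, u} G} (S : SplitExact J M A) :
      Rel (Word.hom (GHom.id J)) ((Word.hom S.i).comp (Word.split S))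
  | homotopy {A B : GAlg.{v, u} G} (Φ : GHom A B.path) (φ₀ φ₁ : GHom A B)
      (h₀ : ∀ a, φ₀.toHom a = evalAt B 0 (Φ.toHom a))
      (h₁ : ∀ a, φ₁.toHom a = evalAt B 1 (Φ.toHom a)) :
      Rel (Word.hom φ₀) (Word.hom φ₁)

/-- The generated relation as a setoid. -/
def relSetoid (A B : GAlg.{v, u} G) : Setoid (Word A B) :=
  ⟨Rel, Rel.refl, Rel.symm, Rel.trans⟩

/-- The morphism set `GK^G(A, B)`. -/
def GK (A B : GAlg.{v, u} G) : Type (max (u + 1) v) := Quotient (relSetoid A B)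

/-- The class in `GK^G(A, B)` of a formal expression. -/
def Word.toGK {A B : GAlg.{v, u} G} (x : Word A B) : GK A B := Quotient.mk (relSetoid A B) x

/-! ### Extended double split exact sequences and level-one morphisms -/

/-- Two homomorphisms `s₋, s₊ : A → X` into the `G`-algebra `X = (X, γ₋)`, the first of them
equivariant, whose difference takes values in the two-sided `G`-invariant ideal `J` of `X`, which
is given by its equivariant embedding `i`. -/
structure DoubleSplit (A X J : GAlg.{v, u} G) where
  i : GHom J X
  i_injective : Function.Injective i.toHom
  mul_mem : ∀ x j, ∃ k, i.toHom k = x * i.toHom j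
  mem_mul : ∀ x j, ∃ k, i.toHom k = i.toHom j * x
  sMinus : GHom A X
  sPlus : A.carrier →ₙₐ[ℂ] X.carrier
  sub_mem : ∀ a, ∃ j, i.toHom j = sPlus a - sMinus.toHom a

namespace DoubleSplit

variable {A X J : GAlg.{v, u} G} (D : DoubleSplit A X J)

/-- The subalgebra `M = X □ A = J ⊕ 0 + (s₋ ⊕ id)(A)` of `X ⊕ A`. -/
def M : NonUnitalSubalgebra ℂ (X.carrier × A.carrier) where
  carrier := {m | ∃ j a, m = (D.i.toHom j + D.sMinus.toHom a, a)}
  zero_mem' := ⟨0, 0, by simp [Prod.zero_eq_mk]⟩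
  add_mem' := by
    rintro _ _ ⟨j, a, rfl⟩ ⟨k, b, rfl⟩
    exact ⟨j + k, a + b, by simp only [map_add, Prod.mk_add_mk]; congr 1; abel⟩
  smul_mem' := by
    rintro c _ ⟨j, a, rfl⟩
    exact ⟨c • j, c • a, by simp⟩
  mul_mem' := by
    rintro _ _ ⟨j, a, rfl⟩ ⟨k, b, rfl⟩
    obtain ⟨l, hl⟩ := D.mul_mem (D.sMinus.toHom a) k
    obtain ⟨n, hn⟩ := D.mem_mul (D.sMinus.toHom b) j
    refine ⟨j * k + n + l, a * b, ?_⟩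
    simp only [map_add, map_mul, Prod.mk_mul_mk, hl, hn]
    congr 1
    noncomm_ring

/-- The inclusion `j ↦ j ⊕ 0` of `J` into `M`. -/
def inclM : J.carrier →ₙₐ[ℂ] D.M where
  toFun j := ⟨(D.i.toHom j, 0), j, 0, by simp⟩
  map_smul' c j := by ext <;> simp
  map_zero' := by ext <;> simp
  map_add' j k := by ext <;> simp
  map_mul' j k := by ext <;> simp

/-- The canonical projection `f : x ⊕ a ↦ a` of `M` onto `A`. -/
def projM : D.M →ₙₐ[ℂ] A.carrier where
  toFun m := m.1.2
  map_smul' _ _ := rfl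
  map_zero' := rfl
  map_add' _ _ := rfl
  map_mul' _ _ := rfl

/-- The homomorphism `s₋ ⊕ id : A → M`. -/
def sMinusM : A.carrier →ₙₐ[ℂ] D.M where
  toFun a := ⟨(D.sMinus.toHom a, a), 0, a, by simp⟩
  map_smul' c a := by ext <;> simp
  map_zero' := by ext <;> simp
  map_add' a b := by ext <;> simp
  map_mul' a b := by ext <;> simp

/-- The homomorphism `s₊ ⊕ id : A → M`. -/
def sPlusM : A.carrier →ₙₐ[ℂ] D.M where
  toFun a := ⟨(D.sPlus a, a), by
    obtain ⟨j, hj⟩ := D.sub_mem a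
    exact ⟨j, a, by simp [hj]⟩⟩
  map_smul' c a := by ext <;> simp
  map_zero' := by ext <;> simp
  map_add' a b := by ext <;> simp
  map_mul' a b := by ext <;> simp

/-- The action `γ₋ ⊕ α`, restricted from `X ⊕ A` to `M`. -/
def minusAct : GAction G D.M where
  toFun g :=
    { toFun := fun m => ⟨(X.act.toFun g m.1.1, A.act.toFun g m.1.2), by
        obtain ⟨j, a, h⟩ := m.2
        rw [h]
        exact ⟨J.act.toFun g j, A.act.toFun g a, by
          simp [D.i.equivariant, D.sMinus.equivariant]⟩⟩
      map_smul' := fun c m => by ext <;> simp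
      map_zero' := by ext <;> simp
      map_add' := fun m n => by ext <;> simp
      map_mul' := fun m n => by ext <;> simp }
  one_apply m := by
    apply Subtype.ext
    exact Prod.ext (X.act.one_apply _) (A.act.one_apply _)
  mul_apply g h m := by
    apply Subtype.ext
    exact Prod.ext (X.act.mul_apply g h _) (A.act.mul_apply g h _)

theorem quadratik_M : IsQuadratik D.M := by
  have hmap : ∀ {C : GAlg.{v, u} G} (φ : C.carrier →ₙₐ[ℂ] D.M) (c : C.carrier),
      φ c ∈ Submodule.span ℂ {m : D.M | ∃ x y, x * y = m} := by
    intro C φ c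
    have hc := C.quadratik c
    induction hc using Submodule.span_induction with
    | mem c hc =>
      obtain ⟨x, y, rfl⟩ := hc
      exact Submodule.subset_span ⟨φ x, φ y, (map_mul φ x y).symm⟩
    | zero => simp
    | add x y _ _ hx hy => rw [map_add]; exact Submodule.add_mem _ hx hy
    | smul c x _ hx => rw [map_smul]; exact Submodule.smul_mem _ c hx
  intro m
  have hm : ∃ j a, m = D.inclM j + D.sMinusM a := by
    obtain ⟨m, j, a, h⟩ := m
    exact ⟨j, a, Subtype.ext (by simp [h, inclM, sMinusM])⟩
  obtain ⟨j, a, rfl⟩ := hm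
  exact Submodule.add_mem _ (hmap D.inclM j) (hmap D.sMinusM a)

/-- `M₋`: the algebra `M` with the action `γ₋ ⊕ α`. -/
abbrev Mminus : GAlg.{v, u} G where
  carrier := D.M
  act := D.minusAct
  quadratik := D.quadratik_M

/-- The split exact sequence `0 → J → M₋ → A → 0` with the split `s₋ ⊕ id`. -/
def splitExact : SplitExact J D.Mminus A where
  i := ⟨D.inclM, fun g j => by
    apply Subtype.ext
    exact Prod.ext (D.i.equivariant g j) (map_zero _).symm⟩
  f := ⟨D.projM, fun _ _ => rfl⟩
  s := ⟨D.sMinusM, fun g a => by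
    apply Subtype.ext
    exact Prod.ext (D.sMinus.equivariant g a) rfl⟩
  i_injective j k h := D.i_injective (congrArg (fun m : D.M => m.1.1) h)
  exact := by
    rintro ⟨m, j, a, h⟩
    constructor
    · intro h0
      have ha : a = 0 := by rw [← h0]; simp [projM, h]
      exact ⟨j, Subtype.ext (by simp [inclM, h, ha])⟩
    · rintro ⟨k, hk⟩
      rw [← hk]
      rfl
  split _ := rfl

end DoubleSplit

/-- An extended double split exact sequence, with corner embedding `e : B → J`, algebra
`M = X □ A`, the second action (that of `M₊`) on `M`, for which `s₊ ⊕ id : A → M₊` and the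
projection `M₊ → A` are equivariant, and the `M₂`-action `δ` on `M₂(M)`, for which the inclusions
`f₁ : M₋ → M₂(M)` and `f₂ : M₊ → M₂(M)` into the top left and the bottom right corner are
equivariant corner embeddings. -/
structure LevelOne (A B X J : GAlg.{v, u} G) extends DoubleSplit A X J where
  e : GHom B J
  e_corner : IsCornerEmbedding e
  plusAct : GAction G toDoubleSplit.M
  projM_plusAct : ∀ g m, toDoubleSplit.projM (plusAct.toFun g m)
    = A.act.toFun g (toDoubleSplit.projM m)
  plusAct_sPlusM : ∀ g a, toDoubleSplit.sPlusM (A.act.toFun g a)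
    = plusAct.toFun g (toDoubleSplit.sPlusM a)
  δ : GAction G (Matrix (Fin 2) (Fin 2) toDoubleSplit.M)
  f₁ : GHom toDoubleSplit.Mminus (toDoubleSplit.Mminus.mat2With δ)
  f₁_apply : ∀ m, f₁.toHom m = Matrix.single 0 0 m
  f₁_corner : IsCornerEmbedding f₁
  f₂ : GHom (⟨toDoubleSplit.M, plusAct, toDoubleSplit.quadratik_M⟩ : GAlg.{v, u} G)
    (toDoubleSplit.Mminus.mat2With δ)
  f₂_apply : ∀ m, f₂.toHom m = Matrix.single 1 1 m
  f₂_corner : IsCornerEmbedding f₂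

namespace LevelOne

variable {A B X J : GAlg.{v, u} G} (D : LevelOne A B X J)

/-- `M₊`: the algebra `M` with the second action. -/
abbrev Mplus : GAlg.{v, u} G := ⟨D.M, D.plusAct, D.quadratik_M⟩

/-- `s₊ ⊕ id` as an equivariant homomorphism `A → M₊`. -/
def sPlusHom : GHom A D.Mplus := ⟨D.sPlusM, D.plusAct_sPlusM⟩

/-- The level-one morphism `s₊ ∇ s₋ = (s₊ ⊕ id) · f₂ · f₁⁻¹ · Δ · e⁻¹` as a formal expression. -/
def word : Word A B :=
  ((((Word.hom D.sPlusHom).comp (Word.hom D.f₂)).comp (Word.cornerInv D.f₁ D.f₁_corner)).comp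
    (Word.split D.splitExact)).comp (Word.cornerInv D.e D.e_corner)

/-- The class of `s₊ ∇ s₋` in `GK^G(A, B)`. -/
def toGK : GK A B := D.word.toGK

end LevelOne

/-! ### The rotation -/

/-- The rotation `U_t ∈ M₂(R)` by the angle `t` in the range of the idempotent `p` of the unital
algebra `R`. -/
def rotation {R : Type u} [Ring R] [Algebra ℂ R] (p : R) (t : ℝ) : Matrix (Fin 2) (Fin 2) R :=
  !![(Real.cos t : ℂ) • p, (Real.sin t : ℂ) • p; -((Real.sin t : ℂ) • p), (Real.cos t : ℂ) • p]
    + !![1 - p, 0; 0, 1 - p]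

/-- `ad(U)(x) = U x U⁻¹` for an invertible matrix `U`. -/
def ad {R : Type u} [Ring R] (U x : Matrix (Fin 2) (Fin 2) R) : Matrix (Fin 2) (Fin 2) R :=
  U * x * Ring.inverse U

end GKTheory

end

noncomputable section

namespace GKTheory

variable {G : Type v} [Group G]

/-! ### Lifting maps through injections -/

/-! Write U for the rotation by the right angle, M for the algebra of the given datum and M' for
that of the rotated one. The map Ψ : M → M', x ⊕ λ ↦ U(x ⊕ λp^⊥)U⁻¹ ⊕ λ, carries s_± ⊕ id to t_± ⊕
id, since U(p ⊕ p^⊥)U⁻¹ = 0 ⊕ 1, and on J it is the corner inclusion J → M₂(J) followed by ad(U).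
Once Ψ respects all actions, naturality of the inverted corner embeddings and of the synthetical
splits identifies the two morphisms up to the factor ad(U) on M₂(J) (`LevelOne.toGK_eq`). This
factor is trivial in GK^G: p is G-invariant, so ad(U_t) is an equivariant homotopy from the identity
to ad(U) (`conj_homotopy`, `DoubleSplit.mor_twist`).

The main work is to find the actions on M' and M₂(M'). The given action on M₂(M) preserves the two
corners, hence acts entrywise. The first column of its entries, restricted to J, gives two
representations of G on J (`rep`), and every entry acts on M/J = ℂ by a scalar (`char`). As the
target of a corner embedding, J has trivial left annihilator; so M' is faithfully represented by
left multiplication on J ⊕ J together with its component in ℂ (`rho_injective`). There the new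
actions are conjugations by the elements `ambientRep a g`, which preserve the image of M'
(`exists_ambientElem_conj`) and also implement the given actions on the image of M
(`ambientHom_entry`). The required corner embeddings come from `isCornerEmbedding_single` and
`isCornerEmbedding_trans_corner`.

The matrix U need not lie in M₂(J⁺). The computations therefore take place in M₂(X⁺) and are pulled
back to M₂(Y⁺) for an algebra Y between J and X; the two cases of the statement are Y = X and Y = J.
-/

/-- A linear map with values in the range of an injective linear map `ι`, lifted through `ι`. -/
def liftLin {U V W : Type*} [AddCommGroup U] [Module ℂ U] [AddCommGroup V] [Module ℂ V]
    [AddCommGroup W] [Module ℂ W] (ι : U →ₗ[ℂ] W) (hι : Function.Injective ι)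
    (φ : V →ₗ[ℂ] W) (h : ∀ x, ∃ y, ι y = φ x) : V →ₗ[ℂ] U :=
  (LinearEquiv.ofInjective ι hι).symm.toLinearMap ∘ₗ φ.codRestrict (LinearMap.range ι) h

theorem liftLin_apply {U V W : Type*} [AddCommGroup U] [Module ℂ U] [AddCommGroup V] [Module ℂ V]
    [AddCommGroup W] [Module ℂ W] (ι : U →ₗ[ℂ] W) (hι : Function.Injective ι)
    (φ : V →ₗ[ℂ] W) (h : ∀ x, ∃ y, ι y = φ x) (x : V) : ι (liftLin ι hι φ h x) = φ x := by
  exact congrArg Subtype.val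
    ((LinearEquiv.ofInjective ι hι).apply_symm_apply (φ.codRestrict (LinearMap.range ι) h x))

/-- A homomorphism with values in the range of an injective homomorphism `ι`, lifted through
`ι`. -/
def liftHom {U V W : Type*} [NonUnitalRing U] [Module ℂ U] [NonUnitalRing V] [Module ℂ V]
    [NonUnitalRing W] [Module ℂ W] (ι : U →ₙₐ[ℂ] W) (hι : Function.Injective ι)
    (φ : V →ₙₐ[ℂ] W) (h : ∀ x, ∃ y, ι y = φ x) : V →ₙₐ[ℂ] U where
  toFun x := (h x).choose
  map_smul' c x := hι <| by
    rw [(h (c • x)).choose_spec, map_smul, map_smul, MonoidHom.id_apply, (h x).choose_spec]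
  map_zero' := hι <| by rw [(h 0).choose_spec, map_zero, map_zero]
  map_add' x y := hι <| by
    rw [(h (x + y)).choose_spec, map_add, map_add, (h x).choose_spec, (h y).choose_spec]
  map_mul' x y := hι <| by
    rw [(h (x * y)).choose_spec, map_mul, map_mul, (h x).choose_spec, (h y).choose_spec]

theorem liftHom_apply {U V W : Type*} [NonUnitalRing U] [Module ℂ U] [NonUnitalRing V]
    [Module ℂ V] [NonUnitalRing W] [Module ℂ W] (ι : U →ₙₐ[ℂ] W) (hι : Function.Injective ι)
    (φ : V →ₙₐ[ℂ] W) (h : ∀ x, ∃ y, ι y = φ x) (x : V) : ι (liftHom ι hι φ h x) = φ x :=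
  (h x).choose_spec

@[ext]
theorem GHom.ext {A B : GAlg.{v, u} G} {φ ψ : GHom A B} (h : ∀ a, φ.toHom a = ψ.toHom a) :
    φ = ψ := by
  cases φ; cases ψ
  congr
  exact NonUnitalAlgHom.ext h

/-! ### The additive category `GK^G` -/

/-- The objects of `GK^G`. -/
structure GKObj (G : Type v) [Group G] where
  alg : GAlg.{v, u} G

open CategoryTheory

instance : Category (GKObj.{v, u} G) where
  Hom A B := GK A.alg B.alg
  id A := (Word.hom (GHom.id A.alg)).toGK
  comp {A B C} := Quotient.map₂ Word.comp fun _ _ h _ _ h' => Rel.comp_congr h h'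
  id_comp := by rintro A B ⟨x⟩; exact Quotient.sound (Rel.id_comp x)
  comp_id := by rintro A B ⟨x⟩; exact Quotient.sound (Rel.comp_id x)
  assoc := by rintro A B C D ⟨x⟩ ⟨y⟩ ⟨z⟩; exact Quotient.sound (Rel.comp_assoc x y z)

instance (A B : GAlg.{v, u} G) : Add (GK A B) :=
  ⟨Quotient.map₂ Word.plus fun _ _ h _ _ h' => Rel.plus_congr h h'⟩

instance (A B : GAlg.{v, u} G) : Zero (GK A B) := ⟨Word.zero.toGK⟩

instance (A B : GAlg.{v, u} G) : Neg (GK A B) :=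
  ⟨Quotient.map Word.neg fun _ _ h => Rel.neg_congr h⟩

instance (A B : GAlg.{v, u} G) : AddCommGroup (GK A B) where
  __ := AddGroup.ofLeftAxioms (G := GK A B)
    (by rintro ⟨x⟩ ⟨y⟩ ⟨z⟩; exact Quotient.sound (Rel.plus_assoc x y z))
    (by rintro ⟨x⟩; exact Quotient.sound (Rel.zero_plus x))
    (by rintro ⟨x⟩; exact Quotient.sound (Rel.neg_plus x))
  add_comm := by rintro ⟨x⟩ ⟨y⟩; exact Quotient.sound (Rel.plus_comm x y)

instance : Preadditive (GKObj.{v, u} G) where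
  homGroup A B := inferInstanceAs (AddCommGroup (GK A.alg B.alg))
  add_comp := by rintro A B C ⟨x⟩ ⟨y⟩ ⟨z⟩; exact Quotient.sound (Rel.plus_comp x y z)
  comp_add := by rintro A B C ⟨x⟩ ⟨y⟩ ⟨z⟩; exact Quotient.sound (Rel.comp_plus x y z)

/-- The class of a formal expression as a morphism of the category `GK^G`. -/
def Word.mor {A B : GAlg.{v, u} G} (x : Word A B) : GKObj.mk A ⟶ GKObj.mk B := x.toGK

theorem Word.mor_comp {A B C : GAlg.{v, u} G} (x : Word A B) (y : Word B C) :
    (x.comp y).mor = x.mor ≫ y.mor := rfl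

/-- The class in `GK^G` of an equivariant homomorphism. -/
def GHom.mor {A B : GAlg.{v, u} G} (φ : GHom A B) : GKObj.mk A ⟶ GKObj.mk B := (Word.hom φ).mor

theorem GHom.mor_trans {A B C : GAlg.{v, u} G} (φ : GHom A B) (ψ : GHom B C) :
    (φ.trans ψ).mor = φ.mor ≫ ψ.mor :=
  (Quotient.sound (Rel.hom_comp φ ψ)).symm

theorem GHom.mor_id (A : GAlg.{v, u} G) : (GHom.id A).mor = 𝟙 (GKObj.mk A) := rfl

theorem mor_comp_cornerInv {A J : GAlg.{v, u} G} (e : GHom A J) (he : IsCornerEmbedding e) :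
    e.mor ≫ (Word.cornerInv e he).mor = 𝟙 _ :=
  Quotient.sound (Rel.corner_inv e he)

theorem cornerInv_comp_mor {A J : GAlg.{v, u} G} (e : GHom A J) (he : IsCornerEmbedding e) :
    (Word.cornerInv e he).mor ≫ e.mor = 𝟙 _ :=
  Quotient.sound (Rel.inv_corner e he)

/-- The inverses of corner embeddings are natural. -/
theorem cornerInv_natural {A J A' J' : GAlg.{v, u} G} {e : GHom A J} (he : IsCornerEmbedding e)
    {e' : GHom A' J'} (he' : IsCornerEmbedding e') {φ : GHom A A'} {ψ : GHom J J'}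
    (h : e.mor ≫ ψ.mor = φ.mor ≫ e'.mor) :
    (Word.cornerInv e he).mor ≫ φ.mor = ψ.mor ≫ (Word.cornerInv e' he').mor := by
  calc (Word.cornerInv e he).mor ≫ φ.mor
      = (Word.cornerInv e he).mor ≫ (φ.mor ≫ e'.mor) ≫ (Word.cornerInv e' he').mor := by
        rw [Category.assoc, mor_comp_cornerInv, Category.comp_id]
    _ = ((Word.cornerInv e he).mor ≫ e.mor) ≫ ψ.mor ≫ (Word.cornerInv e' he').mor := by
        rw [← h]; simp only [Category.assoc]
    _ = _ := by rw [cornerInv_comp_mor, Category.id_comp]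

theorem splitExact_sum {J M A : GAlg.{v, u} G} (S : SplitExact J M A) :
    (Word.split S).mor ≫ S.i.mor + S.f.mor ≫ S.s.mor = 𝟙 _ :=
  (Quotient.sound (Rel.split_sum S)).symm

theorem splitExact_incl {J M A : GAlg.{v, u} G} (S : SplitExact J M A) :
    S.i.mor ≫ (Word.split S).mor = 𝟙 _ :=
  (Quotient.sound (Rel.incl_split S)).symm

/-- Multiplying 1 = Δi + fs from the left by s gives sΔi = 0, because sf = 1. Since iΔ = 1, the
factor i can be cancelled. -/
theorem splitExact_s_comp_split {J M A : GAlg.{v, u} G} (S : SplitExact J M A) :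
    S.s.mor ≫ (Word.split S).mor = 0 := by
  have hsf : S.s.mor ≫ S.f.mor = 𝟙 _ := by
    rw [← GHom.mor_trans, ← GHom.mor_id]
    congr 1
    exact GHom.ext S.split
  have h : S.s.mor ≫ (Word.split S).mor ≫ S.i.mor = 0 := by
    have := congrArg (S.s.mor ≫ ·) (splitExact_sum S)
    simpa [Preadditive.comp_add, reassoc_of% hsf] using this
  calc S.s.mor ≫ (Word.split S).mor
      = (S.s.mor ≫ (Word.split S).mor ≫ S.i.mor) ≫ (Word.split S).mor := by
        simp only [Category.assoc, splitExact_incl, Category.comp_id]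
    _ = 0 := by rw [h, Limits.zero_comp]

/-- The synthetical splits are natural for morphisms of split exact sequences. -/
theorem split_natural {J M A J' M' : GAlg.{v, u} G} (S : SplitExact J M A)
    (S' : SplitExact J' M' A) (k : GHom J J') (Ψ : GHom M M')
    (hi : S.i.trans Ψ = k.trans S'.i) (hs : S.s.trans Ψ = S'.s) :
    (Word.split S).mor ≫ k.mor = Ψ.mor ≫ (Word.split S').mor := by
  have hi' : S.i.mor ≫ Ψ.mor = k.mor ≫ S'.i.mor := by
    rw [← GHom.mor_trans, ← GHom.mor_trans, hi]
  have hs' : S.s.mor ≫ Ψ.mor = S'.s.mor := by rw [← GHom.mor_trans, hs]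
  -- The decomposition 1 = Δi + fs is multiplied by ΨΔ': the first summand becomes Δki'Δ' = Δk, and
  -- the second contains s'Δ' = 0.
  have := congrArg (· ≫ Ψ.mor ≫ (Word.split S').mor) (splitExact_sum S)
  simp only [Preadditive.add_comp, Category.assoc, Category.id_comp, reassoc_of% hi',
    reassoc_of% hs', splitExact_incl, splitExact_s_comp_split, Limits.comp_zero, add_zero,
    Category.comp_id] at this
  exact this

/-- A morphism of extended double split exact sequences that is compatible with the corner
embeddings identifies the level-one morphisms. -/
theorem LevelOne.toGK_eq {A B X J X' J' : GAlg.{v, u} G} (D : LevelOne A B X J)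
    (T : LevelOne A B X' J') (k : GHom J J') (Ψ : D.M →ₙₐ[ℂ] T.M)
    (hincl : ∀ j, Ψ (D.inclM j) = T.inclM (k.toHom j))
    (hminus : ∀ a, Ψ (D.sMinusM a) = T.sMinusM a)
    (hplus : ∀ a, Ψ (D.sPlusM a) = T.sPlusM a)
    (hminusAct : ∀ g m, Ψ (D.minusAct.toFun g m) = T.minusAct.toFun g (Ψ m))
    (hplusAct : ∀ g m, Ψ (D.plusAct.toFun g m) = T.plusAct.toFun g (Ψ m))
    (hδ : ∀ g m, mat2Map Ψ (D.δ.toFun g m) = T.δ.toFun g (mat2Map Ψ m))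
    (he : D.e.mor ≫ k.mor = T.e.mor) : D.toGK = T.toGK := by
  let Ψm : GHom D.Mminus T.Mminus := ⟨Ψ, hminusAct⟩
  let Ψp : GHom D.Mplus T.Mplus := ⟨Ψ, hplusAct⟩
  let Ψ2 : GHom (D.Mminus.mat2With D.δ) (T.Mminus.mat2With T.δ) := ⟨mat2Map Ψ, hδ⟩
  have hs : D.sPlusHom.mor ≫ Ψp.mor = T.sPlusHom.mor := by
    rw [← GHom.mor_trans]; congr 1; exact GHom.ext hplus
  have single (i : Fin 2) (m : D.M) :
      mat2Map Ψ (Matrix.single i i m) = Matrix.single i i (Ψ m) := by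
    ext1 a b
    simp only [mat2Map, NonUnitalAlgHom.coe_mk, Matrix.map_apply, Matrix.single_apply]
    split_ifs <;> simp
  have h₂ : D.f₂.mor ≫ Ψ2.mor = Ψp.mor ≫ T.f₂.mor := by
    rw [← GHom.mor_trans, ← GHom.mor_trans]; congr 1
    refine GHom.ext fun m => ?_
    change mat2Map Ψ (D.f₂.toHom m) = T.f₂.toHom (Ψ m)
    rw [D.f₂_apply, T.f₂_apply, single]
  have h₁ : D.f₁.mor ≫ Ψ2.mor = Ψm.mor ≫ T.f₁.mor := by
    rw [← GHom.mor_trans, ← GHom.mor_trans]; congr 1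
    refine GHom.ext fun m => ?_
    change mat2Map Ψ (D.f₁.toHom m) = T.f₁.toHom (Ψ m)
    rw [D.f₁_apply, T.f₁_apply, single]
  have h₁' := cornerInv_natural D.f₁_corner T.f₁_corner h₁
  have hΔ := split_natural D.splitExact T.splitExact k Ψm (GHom.ext hincl) (GHom.ext hminus)
  -- Here `he` is an equation of classes: the embeddings of B need to match only in GK^G, for
  -- instance up to homotopy.
  have he' : (Word.cornerInv D.e D.e_corner).mor = k.mor ≫ (Word.cornerInv T.e T.e_corner).mor := by
    rw [← cornerInv_natural (φ := GHom.id B) D.e_corner T.e_corner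
      (by rw [he, GHom.mor_id, Category.id_comp]), GHom.mor_id, Category.comp_id]
  change D.word.mor = T.word.mor
  simp only [LevelOne.word, Word.mor_comp]
  change (((D.sPlusHom.mor ≫ D.f₂.mor) ≫ _) ≫ _) ≫ _ = (((T.sPlusHom.mor ≫ T.f₂.mor) ≫ _) ≫ _) ≫ _
  rw [he', ← hs]
  simp only [Category.assoc, reassoc_of% hΔ, reassoc_of% h₁', reassoc_of% h₂]

/-! ### Corner embeddings -/

/-- The target of a corner embedding has trivial left annihilator. -/
theorem IsCornerEmbedding.eq_zero_of_mul_eq_zero {A J : GAlg.{v, u} G} {e : GHom A J}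
    (he : IsCornerEmbedding e) {x : J.carrier} (hx : ∀ y, x * y = 0) : x = 0 := by
  obtain ⟨E, hE, π, hinj, hrange, -, -⟩ := he
  refine hinj ((LinearMap.ext fun ζ => ?_).trans (map_zero π).symm)
  have hζ : ζ ∈ Submodule.span ℂ {ζ | ∃ ξ, ∃ φ ∈ E.sumSelf.functionals, ∃ η,
      ζ = E.sumSelf.rsmul ξ (φ η)} := by
    rw [show Submodule.span ℂ _ = ⊤ from hE]; trivial
  induction hζ using Submodule.span_induction with
  | mem ζ h =>
    obtain ⟨ξ, φ, hφ, η, rfl⟩ := h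
    have hT : E.sumSelf.elementary ξ φ ∈ Set.range π := by
      rw [hrange]; exact Submodule.subset_span ⟨ξ, φ, hφ, rfl⟩
    obtain ⟨y, hy⟩ := hT
    -- The operator η ↦ ξφ(η) is π(y) for some y in J, so π(x) maps ξφ(η) to π(xy)η = 0. By
    -- cofullness such vectors span.
    change π x (E.sumSelf.elementary ξ φ η) = 0
    rw [← hy, ← Module.End.mul_apply, ← map_mul, hx, map_zero, LinearMap.zero_apply]
  | zero => simp
  | add ζ ζ' _ _ h h' => rw [map_add, h, h']; simp
  | smul c ζ _ h => rw [map_smul, h]; simp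

theorem IsQuadratik.induction {A : Type u} [NonUnitalRing A] [Module ℂ A] (h : IsQuadratik A)
    {p : A → Prop} (mul : ∀ x y, p (x * y)) (zero : p 0) (add : ∀ x y, p x → p y → p (x + y))
    (smul : ∀ (c : ℂ) x, p x → p (c • x)) (a : A) : p a := by
  have ha := h a
  induction ha using Submodule.span_induction with
  | mem c hc => obtain ⟨x, y, rfl⟩ := hc; exact mul x y
  | zero => exact zero
  | add x y _ _ hx hy => exact add x y hx hy
  | smul c x _ hx => exact smul c x hx

/-! ### Actions on 2 × 2 matrices that preserve the two corners -/

namespace GAction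

variable {A : Type u} [NonUnitalRing A] [Module ℂ A]

/-- The component at the position `(a, b)` of an action on `M₂(A)`. -/
def entry (δ : GAction G (Matrix (Fin 2) (Fin 2) A)) (g : G) (a b : Fin 2) : A →ₗ[ℂ] A where
  toFun m := δ.toFun g (Matrix.single a b m) a b
  map_add' m n := by simp [Matrix.single_add]
  map_smul' c m := by simp [← Matrix.smul_single]

/-- An action on `M₂(A)` is diagonal if it preserves the two corners. -/
def IsDiagonal (δ : GAction G (Matrix (Fin 2) (Fin 2) A)) : Prop :=
  ∀ g k m, ∃ n, δ.toFun g (Matrix.single k k m) = Matrix.single k k n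

variable {δ : GAction G (Matrix (Fin 2) (Fin 2) A)}

/-- A diagonal action on `2 × 2` matrices over a quadratik algebra acts entrywise. -/
theorem IsDiagonal.apply_single (hδ : δ.IsDiagonal) (hA : IsQuadratik A) (g : G) (a b : Fin 2)
    (m : A) : δ.toFun g (Matrix.single a b m) = Matrix.single a b (δ.entry g a b m) := by
  suffices h : ∀ c d, ¬(a = c ∧ b = d) → δ.toFun g (Matrix.single a b m) c d = 0 by
    ext c d
    by_cases hcd : a = c ∧ b = d
    · obtain ⟨rfl, rfl⟩ := hcd; simp [entry]
    · rw [h c d hcd, Matrix.single_apply, if_neg hcd]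
  intro c d hcd
  rw [not_and_or] at hcd
  induction m using hA.induction with
  -- The factorization e_ab(xy) = e_aa(x) e_ab(y) confines the image to row a, and e_ab(xy) =
  -- e_ab(x) e_bb(y) confines it to column b.
  | mul x y =>
    rcases hcd with hc | hd
    · obtain ⟨n, hn⟩ := hδ g a x
      rw [← Matrix.single_mul_single_same x a a b, map_mul, hn, Matrix.mul_apply]
      exact Finset.sum_eq_zero fun k _ => by simp [hc]
    · obtain ⟨n, hn⟩ := hδ g b y
      rw [← Matrix.single_mul_single_same x a b b, map_mul, hn, Matrix.mul_apply]
      exact Finset.sum_eq_zero fun k _ => by simp [hd]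
  | zero => simp
  | add x y hx hy => rw [Matrix.single_add, map_add, Matrix.add_apply, hx, hy, add_zero]
  | smul t x hx => rw [← Matrix.smul_single, map_smul, Matrix.smul_apply, hx, smul_zero]

theorem IsDiagonal.apply (hδ : δ.IsDiagonal) (hA : IsQuadratik A) (g : G)
    (m : Matrix (Fin 2) (Fin 2) A) (a b : Fin 2) :
    δ.toFun g m a b = δ.entry g a b (m a b) := by
  conv_lhs => rw [Matrix.matrix_eq_sum_single m]
  simp only [map_sum, Matrix.sum_apply, hδ.apply_single hA]
  rw [Finset.sum_eq_single a, Finset.sum_eq_single b]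
  · simp
  · intro d _ hd; simp [hd]
  · simp
  · intro c _ hc; exact Finset.sum_eq_zero fun d _ => by simp [hc]
  · simp

/-- Compare the images of both sides of e_ac(mn) = e_ab(m) e_bc(n). The freedom in the middle index
b ties the off-diagonal entries to the diagonal ones. -/
theorem IsDiagonal.entry_mul (hδ : δ.IsDiagonal) (hA : IsQuadratik A) (g : G) (a b c : Fin 2)
    (m n : A) : δ.entry g a c (m * n) = δ.entry g a b m * δ.entry g b c n := by
  have h : δ.toFun g (Matrix.single a c (m * n)) a c
      = (δ.toFun g (Matrix.single a b m) * δ.toFun g (Matrix.single b c n)) a c := by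
    rw [← map_mul, Matrix.single_mul_single_same]
  rw [hδ.apply_single hA, hδ.apply_single hA, hδ.apply_single hA,
    Matrix.single_mul_single_same] at h
  simpa using h

theorem entry_one (δ : GAction G (Matrix (Fin 2) (Fin 2) A)) (a b : Fin 2) (m : A) :
    δ.entry 1 a b m = m := by
  simp [entry, δ.one_apply]

theorem IsDiagonal.entry_entry (hδ : δ.IsDiagonal) (hA : IsQuadratik A) (g h : G) (a b : Fin 2)
    (m : A) : δ.entry (g * h) a b m = δ.entry g a b (δ.entry h a b m) := by
  change δ.toFun (g * h) (Matrix.single a b m) a b = _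
  rw [δ.mul_apply, hδ.apply_single hA, hδ.apply_single hA]
  simp

theorem IsDiagonal.entry_entry_inv (hδ : δ.IsDiagonal) (hA : IsQuadratik A) (g : G)
    (a b : Fin 2) (m : A) : δ.entry g a b (δ.entry g⁻¹ a b m) = m := by
  rw [← hδ.entry_entry hA, mul_inv_cancel, entry_one]

end GAction

theorem sum_fin_two_of_ne {M : Type*} [AddCommMonoid M] {i j : Fin 2} (hij : i ≠ j)
    (x : Fin 2 → M) : ∑ k, x k = x i + x j := by
  rw [← Finset.sum_pair hij]
  congr 1
  ext k
  simp only [Finset.mem_univ, Finset.mem_insert, Finset.mem_singleton, true_iff]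
  omega

/-- The functional module over the algebra at the corner `i`, that is given by the off-diagonal
part of an action on `2 × 2` matrices. -/
abbrev offDiagonal (N : GAlg.{v, u} G) (δ : GAction G (Matrix (Fin 2) (Fin 2) N.carrier))
    (hδ : δ.IsDiagonal) (i j : Fin 2) (hi : ∀ g m, δ.entry g i i m = N.act.toFun g m) :
    FunctionalModule N where
  carrier := N.carrier
  rsmul := LinearMap.mul ℂ N.carrier
  rsmul_mul ξ a b := (mul_assoc ξ a b).symm
  -- Vectors move by the entry (j, i), which is compatible with right multiplication by the corner
  -- (i, i). Functionals are left multiplications and move by the transposed entry (i, j).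
  act g := δ.entry g j i
  act_one := δ.entry_one j i
  act_mul g h := hδ.entry_entry N.quadratik g h j i
  act_rsmul g ξ a := by
    rw [← hi]
    exact hδ.entry_mul N.quadratik g j i i ξ a
  functionals := LinearMap.range (LinearMap.mul ℂ N.carrier)
  functional_rsmul := by
    rintro _ ⟨φ, rfl⟩ ξ a
    exact (mul_assoc φ ξ a).symm
  mul_functional := by
    rintro _ ⟨φ, rfl⟩ a
    exact ⟨a * φ, LinearMap.ext fun ξ => mul_assoc a φ ξ⟩
  act_functional := by
    rintro _ ⟨φ, rfl⟩ g
    refine ⟨δ.entry g i j φ, LinearMap.ext fun ξ => ?_⟩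
    change δ.entry g i j φ * ξ = N.act.toFun g (φ * δ.entry g⁻¹ j i ξ)
    rw [← hi, hδ.entry_mul N.quadratik g i j i, hδ.entry_entry_inv N.quadratik]

/-- The action of `2 × 2` matrices on columns, whose components `j` and `i` are separated. -/
def columnRep (A : Type u) [NonUnitalRing A] [Module ℂ A] [IsScalarTower ℂ A A]
    [SMulCommClass ℂ A A] {i j : Fin 2} (hij : i ≠ j) :
    Matrix (Fin 2) (Fin 2) A →ₙₐ[ℂ] Module.End ℂ (A × A) where
  toFun m :=
    { toFun := fun ξ => (m j j * ξ.1 + m j i * ξ.2, m i j * ξ.1 + m i i * ξ.2)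
      map_add' := fun ξ η => by ext <;> simp only [Prod.fst_add, Prod.snd_add] <;> noncomm_ring
      map_smul' := fun c ξ => by ext <;> simp [mul_smul_comm] }
  map_smul' c m := by ext <;> simp [smul_mul_assoc]
  map_zero' := by ext <;> simp
  map_add' m n := by ext <;> simp [add_mul]
  map_mul' m n := by
    ext ξ <;> simp [Matrix.mul_apply, sum_fin_two_of_ne hij, mul_assoc, add_mul, add_comm]

/-- If an action on `M₂(N)` preserves the two corners and `N` has trivial left annihilator, then
the inclusion of the corner at `(i, i)` is a corner embedding. -/
theorem isCornerEmbedding_single (N : GAlg.{v, u} G)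
    (δ : GAction G (Matrix (Fin 2) (Fin 2) N.carrier)) (hδ : δ.IsDiagonal)
    (hN : ∀ x : N.carrier, (∀ y, x * y = 0) → x = 0) {i j : Fin 2} (hij : i ≠ j)
    (f : GHom N (N.mat2With δ)) (hf : ∀ m, f.toHom m = Matrix.single i i m) :
    IsCornerEmbedding f := by
  have hi : ∀ g m, δ.entry g i i m = N.act.toFun g m := fun g m => by
    have := f.equivariant g m
    rw [hf, hf] at this
    change _ = δ.toFun g _ at this
    rw [hδ.apply_single N.quadratik] at this
    simpa using (congrFun (congrFun this i) i).symm
  refine ⟨offDiagonal N δ hδ i j hi, ?_, columnRep N.carrier hij, ?_, ?_, ?_, ?_⟩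
  -- The vector x(yz) is ξ·φ(η) with φ the left multiplication by y. Three factors are needed, so
  -- that N is split into products twice.
  · have key : ∀ (l : N.carrier →ₗ[ℂ] N.carrier × N.carrier),
        (∀ x y z, ∃ ξ, ∃ φ ∈ (offDiagonal N δ hδ i j hi).sumSelf.functionals, ∃ η,
          l (x * (y * z)) = (offDiagonal N δ hδ i j hi).sumSelf.rsmul ξ (φ η)) →
        ∀ x, l x ∈ Submodule.span ℂ {ζ | ∃ ξ,
          ∃ φ ∈ (offDiagonal N δ hδ i j hi).sumSelf.functionals, ∃ η,
          ζ = (offDiagonal N δ hδ i j hi).sumSelf.rsmul ξ (φ η)} := by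
      intro l hl x
      induction x using N.quadratik.induction with
      | mul x y =>
        induction y using N.quadratik.induction with
        | mul y z => exact Submodule.subset_span (hl x y z)
        | zero => rw [mul_zero, map_zero]; exact Submodule.zero_mem _
        | add y y' h h' => rw [mul_add, map_add]; exact Submodule.add_mem _ h h'
        | smul c y h => rw [mul_smul_comm, map_smul]; exact Submodule.smul_mem _ c h
      | zero => rw [map_zero]; exact Submodule.zero_mem _
      | add y y' h h' => rw [map_add]; exact Submodule.add_mem _ h h'
      | smul c y h => rw [map_smul]; exact Submodule.smul_mem _ c h
    refine Submodule.eq_top_iff'.2 fun ζ => ?_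
    have h₁ := key (LinearMap.inl ℂ _ _) (fun x y z => ⟨(x, 0), _,
      ⟨LinearMap.mul ℂ _ y, ⟨y, rfl⟩, 0, rfl⟩, (z, 0), by ext <;> simp⟩) ζ.1
    have h₂ := key (LinearMap.inr ℂ _ _) (fun x y z => ⟨(0, x), _,
      ⟨LinearMap.mul ℂ _ 0, ⟨0, rfl⟩, y, rfl⟩, (0, z), by ext <;> simp⟩) ζ.2
    have := Submodule.add_mem _ h₁ h₂
    simpa using this
  · rw [injective_iff_map_eq_zero]
    intro m hm
    have h₁ : ∀ y, m j j * y = 0 ∧ m i j * y = 0 := fun y => by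
      simpa [columnRep] using LinearMap.congr_fun hm (y, 0)
    have h₂ : ∀ y, m j i * y = 0 ∧ m i i * y = 0 := fun y => by
      simpa [columnRep] using LinearMap.congr_fun hm (0, y)
    have hfin : ∀ k : Fin 2, k = i ∨ k = j := fun k => by omega
    ext a b
    rcases hfin a with rfl | rfl <;> rcases hfin b with rfl | rfl
    · exact hN _ fun y => (h₂ y).2
    · exact hN _ fun y => (h₁ y).2
    · exact hN _ fun y => (h₂ y).1
    · exact hN _ fun y => (h₁ y).1
  -- An elementary operator is the matrix of products of the column ξ with the row (b, a) of the
  -- functional.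
  · have hel : ∀ (ξ : N.carrier × N.carrier) (b a : N.carrier),
        columnRep N.carrier hij (fun r s => (if r = j then ξ.1 else ξ.2) * (if s = j then b else a))
        = (offDiagonal N δ hδ i j hi).sumSelf.elementary ξ
            (LinearMap.mul ℂ _ b ∘ₗ LinearMap.fst ℂ _ _
              + LinearMap.mulLeft ℂ a ∘ₗ LinearMap.snd ℂ _ _) := by
      intro ξ b a
      refine LinearMap.ext fun η => ?_
      ext <;> simp [columnRep, FunctionalModule.elementary, hij, mul_add, mul_assoc]
    apply Set.Subset.antisymm
    · rintro _ ⟨m, rfl⟩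
      have hs : ∀ a b x, columnRep N.carrier hij (Matrix.single a b x)
          ∈ (offDiagonal N δ hδ i j hi).sumSelf.compacts := by
        intro a b x
        induction x using N.quadratik.induction with
        | mul x y =>
          -- The matrix e_ab(xy) is the elementary operator with the column x at position a and the
          -- row y at position b. Index j belongs to the added module, index i to the summand N.
          refine Submodule.subset_span ⟨(if a = j then x else 0, if a = j then 0 else x), _,
            ⟨_, ⟨if b = j then y else 0, rfl⟩, if b = j then 0 else y, rfl⟩, ?_⟩
          rw [← hel]
          congr 1
          ext r s
          have hfin : ∀ k : Fin 2, k = i ∨ k = j := fun k => by omega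
          rcases hfin a with rfl | rfl <;> rcases hfin b with rfl | rfl <;>
            rcases hfin r with rfl | rfl <;> rcases hfin s with rfl | rfl <;>
            simp [hij, hij.symm]
        | zero => rw [Matrix.single_zero, map_zero]; exact Submodule.zero_mem _
        | add x y h h' => rw [Matrix.single_add, map_add]; exact Submodule.add_mem _ h h'
        | smul c x h => rw [← Matrix.smul_single, map_smul]; exact Submodule.smul_mem _ c h
      rw [Matrix.matrix_eq_sum_single m]
      simp only [map_sum]
      exact Submodule.sum_mem _ fun a _ => Submodule.sum_mem _ fun b _ => hs a b _
    · intro T hT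
      refine (Submodule.span_le (p := LinearMap.range
        (columnRep N.carrier hij : Matrix (Fin 2) (Fin 2) N.carrier →ₗ[ℂ]
          Module.End ℂ (N.carrier × N.carrier)))).2 ?_ hT
      rintro _ ⟨ξ, _, ⟨_, ⟨b, rfl⟩, a, rfl⟩, rfl⟩
      exact ⟨fun r s => (if r = j then ξ.1 else ξ.2) * (if s = j then b else a), hel ξ b a⟩
  · intro g m
    refine LinearMap.ext fun ξ => ?_
    -- The index c is free; it is taken to be i, since columns are moved by the entries (j, i) and
    -- (i, i).
    have h : ∀ a b c (x y : N.carrier), δ.entry g a b x * y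
        = δ.entry g a c (x * δ.entry g⁻¹ b c y) := fun a b c x y => by
      rw [hδ.entry_mul N.quadratik g a b c, hδ.entry_entry_inv N.quadratik]
    ext
    · simp [columnRep, hδ.apply N.quadratik, ← hi, h _ _ i]
    · simp [columnRep, hδ.apply N.quadratik, ← hi, h _ _ i]
  · intro a ξ b
    ext <;> simp [columnRep, hf, hij]

/-! ### Enlarging a corner embedding by 2 × 2 matrices -/

/-- The direct sum of two functional modules. -/
abbrev FunctionalModule.prod {A : GAlg.{v, u} G} (E F : FunctionalModule A) :
    FunctionalModule A where
  carrier := E.carrier × F.carrier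
  rsmul := LinearMap.mk₂ ℂ (fun ξ a => (E.rsmul ξ.1 a, F.rsmul ξ.2 a))
    (fun ξ η a => by simp) (fun c ξ a => by simp)
    (fun ξ a b => by simp) (fun c ξ a => by simp)
  rsmul_mul ξ a b := by simp [E.rsmul_mul, F.rsmul_mul]
  act g := (E.act g).prodMap (F.act g)
  act_one ξ := by ext <;> simp [E.act_one, F.act_one]
  act_mul g h ξ := by ext <;> simp [E.act_mul, F.act_mul]
  act_rsmul g ξ a := by ext <;> simp [E.act_rsmul, F.act_rsmul]
  functionals := (E.functionals.prod F.functionals).map (LinearMap.coprodEquiv ℂ).toLinearMap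
  functional_rsmul := by
    rintro _ ⟨⟨φ, ψ⟩, ⟨hφ, hψ⟩, rfl⟩ ξ a
    simp [E.functional_rsmul φ hφ, F.functional_rsmul ψ hψ, add_mul]
  mul_functional := by
    rintro _ ⟨⟨φ, ψ⟩, ⟨hφ, hψ⟩, rfl⟩ a
    exact ⟨⟨_, _⟩, ⟨E.mul_functional φ hφ a, F.mul_functional ψ hψ a⟩, by ext <;> simp⟩
  act_functional := by
    rintro _ ⟨⟨φ, ψ⟩, ⟨hφ, hψ⟩, rfl⟩ g
    exact ⟨⟨_, _⟩, ⟨E.act_functional φ hφ g, F.act_functional ψ hψ g⟩, by ext <;> simp⟩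

/-- The inclusion of an algebra into the top left corner of its `2 × 2` matrices. -/
def GAlg.corner (J : GAlg.{v, u} G) : GHom J J.mat2 where
  toHom :=
    { toFun := Matrix.single 0 0
      map_smul' := fun c x => by simp [Matrix.smul_single]
      map_zero' := by simp
      map_add' := Matrix.single_add 0 0
      map_mul' := fun x y => by simp }
  equivariant g x := by
    change Matrix.single 0 0 _ = (Matrix.single 0 0 x).map _
    ext a b
    simp only [Matrix.map_apply, Matrix.single_apply]
    split_ifs <;> simp

/-- Matrices of operators as operators on `(E × V) × (E × V)`, regrouped as
`(E × (E × V)) × V`. -/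
def regroupRep {J : Type u} [NonUnitalRing J] [Module ℂ J] {E V : Type u} [AddCommGroup E]
    [Module ℂ E] [AddCommGroup V] [Module ℂ V] (π : J →ₙₐ[ℂ] Module.End ℂ (E × V)) :
    Matrix (Fin 2) (Fin 2) J →ₙₐ[ℂ] Module.End ℂ ((E × (E × V)) × V) where
  toFun m :=
    { toFun := fun ζ =>
        (((π (m 0 0) (ζ.1.1, ζ.2) + π (m 0 1) ζ.1.2).1,
          π (m 1 0) (ζ.1.1, ζ.2) + π (m 1 1) ζ.1.2),
          (π (m 0 0) (ζ.1.1, ζ.2) + π (m 0 1) ζ.1.2).2)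
      map_add' := fun ζ η => by
        have h : ((ζ + η).1.1, (ζ + η).2) = (ζ.1.1, ζ.2) + (η.1.1, η.2) := rfl
        have h' : (ζ + η).1.2 = ζ.1.2 + η.1.2 := rfl
        rw [h, h']
        ext <;> simp only [map_add, Prod.fst_add, Prod.snd_add] <;> abel
      map_smul' := fun c ζ => by
        have h : ((c • ζ).1.1, (c • ζ).2) = c • (ζ.1.1, ζ.2) := rfl
        have h' : (c • ζ).1.2 = c • ζ.1.2 := rfl
        rw [h, h']
        ext <;> simp only [map_smul, Prod.smul_fst, Prod.smul_snd, smul_add, Prod.fst_add,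
          Prod.snd_add, RingHom.id_apply] }
  map_smul' c m := by
    refine LinearMap.ext fun ζ => ?_
    ext <;> simp
  map_zero' := by
    refine LinearMap.ext fun ζ => ?_
    ext <;> simp
  map_add' m n := by
    refine LinearMap.ext fun ζ => ?_
    ext <;> simp <;> abel
  map_mul' m n := by
    refine LinearMap.ext fun ζ => ?_
    simp only [Matrix.mul_apply, Fin.sum_univ_two, map_add, map_mul, LinearMap.add_apply,
      Module.End.mul_apply, LinearMap.coe_mk, AddHom.coe_mk, Prod.mk.eta]
    ext <;> simp only [Prod.fst_add, Prod.snd_add] <;> abel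

/-- The two columns of `(E × (E × V)) × V`, regrouped from `(E × V) × (E × V)`. -/
def regroupIncl (E V : Type u) [AddCommGroup E] [Module ℂ E] [AddCommGroup V] [Module ℂ V] :
    Fin 2 → (E × V →ₗ[ℂ] (E × (E × V)) × V) :=
  ![(LinearMap.inl ℂ E (E × V)).prodMap LinearMap.id,
    LinearMap.inl ℂ (E × (E × V)) V ∘ₗ LinearMap.inr ℂ E (E × V)]

/-- The projections onto the two columns. -/
def regroupProj (E V : Type u) [AddCommGroup E] [Module ℂ E] [AddCommGroup V] [Module ℂ V] :
    Fin 2 → ((E × (E × V)) × V →ₗ[ℂ] E × V) :=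
  ![(LinearMap.fst ℂ E (E × V)).prodMap LinearMap.id,
    LinearMap.snd ℂ E (E × V) ∘ₗ LinearMap.fst ℂ (E × (E × V)) V]

theorem regroupRep_single {J : Type u} [NonUnitalRing J] [Module ℂ J] {E V : Type u}
    [AddCommGroup E] [Module ℂ E] [AddCommGroup V] [Module ℂ V]
    (π : J →ₙₐ[ℂ] Module.End ℂ (E × V)) (r s : Fin 2) (x : J) :
    regroupRep π (Matrix.single r s x) = regroupIncl E V r ∘ₗ π x ∘ₗ regroupProj E V s := by
  refine LinearMap.ext fun ζ => ?_
  fin_cases r <;> fin_cases s <;> ext <;> simp [regroupRep, regroupIncl, regroupProj]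

theorem regroupProj_regroupRep {J : Type u} [NonUnitalRing J] [Module ℂ J] {E V : Type u}
    [AddCommGroup E] [Module ℂ E] [AddCommGroup V] [Module ℂ V]
    (π : J →ₙₐ[ℂ] Module.End ℂ (E × V)) (m : Matrix (Fin 2) (Fin 2) J) (r s : Fin 2)
    (w : E × V) :
    regroupProj E V r (regroupRep π m (regroupIncl E V s w)) = π (m r s) w := by
  have h0 : ((0 : E), (0 : V)) = 0 := rfl
  fin_cases r <;> fin_cases s <;> simp [regroupRep, regroupIncl, regroupProj, h0]

theorem regroupProj_functional {B : GAlg.{v, u} G} (E : FunctionalModule B)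
    {φ : E.carrier × B.carrier →ₗ[ℂ] B.carrier} (hφ : φ ∈ E.sumSelf.functionals) (s : Fin 2) :
    φ ∘ₗ regroupProj E.carrier B.carrier s ∈ (E.prod E.sumSelf).sumSelf.functionals := by
  fin_cases s
  · obtain ⟨φ, hφ, a, rfl⟩ := hφ
    exact ⟨_, ⟨⟨φ, 0⟩, ⟨hφ, Submodule.zero_mem _⟩, rfl⟩, a, by ext <;> simp [regroupProj]⟩
  · exact ⟨_, ⟨⟨0, φ⟩, ⟨Submodule.zero_mem _, hφ⟩, rfl⟩, 0, by ext <;> simp [regroupProj]⟩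

theorem regroupIncl_rsmul {B : GAlg.{v, u} G} (E : FunctionalModule B) (r : Fin 2)
    (ξ : E.carrier × B.carrier) (b : B.carrier) :
    regroupIncl E.carrier B.carrier r (E.sumSelf.rsmul ξ b)
      = (E.prod E.sumSelf).sumSelf.rsmul (regroupIncl E.carrier B.carrier r ξ) b := by
  fin_cases r <;> ext <;> simp [regroupIncl]

/-- Corner embeddings can be enlarged by a passage to `2 × 2` matrices. -/
theorem isCornerEmbedding_trans_corner {B J : GAlg.{v, u} G} {e : GHom B J}
    (he : IsCornerEmbedding e) : IsCornerEmbedding (e.trans J.corner) := by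
  obtain ⟨E, hE, π, hinj, hrange, hequiv, hcorner⟩ := he
  -- M₂(K(E ⊕ B)) acts on two copies of E ⊕ B. The summand B of the first copy stays distinguished,
  -- so E ⊕ (E ⊕ B) is the new module.
  refine ⟨E.prod E.sumSelf, ?_, regroupRep π, ?_, ?_, ?_, ?_⟩
  · have key : ∀ r x, regroupIncl E.carrier B.carrier r x ∈ Submodule.span ℂ {ζ | ∃ ξ,
        ∃ φ ∈ (E.prod E.sumSelf).sumSelf.functionals, ∃ η,
        ζ = (E.prod E.sumSelf).sumSelf.rsmul ξ (φ η)} := by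
      intro r x
      have hx : x ∈ Submodule.span ℂ {ζ | ∃ ξ, ∃ φ ∈ E.sumSelf.functionals, ∃ η,
          ζ = E.sumSelf.rsmul ξ (φ η)} := by
        rw [show Submodule.span ℂ _ = ⊤ from hE]; trivial
      induction hx using Submodule.span_induction with
      | mem ζ h =>
        obtain ⟨ξ, φ, hφ, η, rfl⟩ := h
        exact Submodule.subset_span ⟨_, _, regroupProj_functional E hφ 1, ((0, η), 0),
          regroupIncl_rsmul E r ξ (φ η)⟩
      | zero => rw [map_zero]; exact Submodule.zero_mem _
      | add y y' _ _ h h' => rw [map_add]; exact Submodule.add_mem _ h h'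
      | smul c y _ h => rw [map_smul]; exact Submodule.smul_mem _ c h
    refine Submodule.eq_top_iff'.2 fun ζ => ?_
    have := Submodule.add_mem _ (key 0 (ζ.1.1, ζ.2)) (key 1 ζ.1.2)
    simpa [regroupIncl] using this
  · rw [injective_iff_map_eq_zero]
    intro m hm
    have h : ∀ r s, m r s = 0 := by
      intro r s
      refine hinj ((LinearMap.ext fun w => ?_).trans (map_zero π).symm)
      rw [← regroupProj_regroupRep, hm, LinearMap.zero_apply, map_zero, LinearMap.zero_apply]
    exact Matrix.ext h
  · apply Set.Subset.antisymm
    · rintro _ ⟨m, rfl⟩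
      rw [Matrix.matrix_eq_sum_single m]
      simp only [map_sum, regroupRep_single]
      refine Submodule.sum_mem _ fun r _ => Submodule.sum_mem _ fun s _ => ?_
      have hT : π (m r s) ∈ E.sumSelf.compacts := by
        rw [← SetLike.mem_coe, ← hrange]; exact ⟨_, rfl⟩
      generalize π (m r s) = T at hT
      induction hT using Submodule.span_induction with
      | mem T h =>
        obtain ⟨ξ, φ, hφ, rfl⟩ := h
        exact Submodule.subset_span ⟨_, _, regroupProj_functional E hφ s,
          LinearMap.ext fun η => regroupIncl_rsmul E r ξ _⟩
      | zero => rw [LinearMap.zero_comp, LinearMap.comp_zero]; exact Submodule.zero_mem _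
      | add T T' _ _ h h' =>
        rw [LinearMap.add_comp, LinearMap.comp_add]; exact Submodule.add_mem _ h h'
      | smul c T _ h =>
        rw [LinearMap.smul_comp, LinearMap.comp_smul]; exact Submodule.smul_mem _ c h
    · intro T hT
      refine (Submodule.span_le (p := LinearMap.range
        (regroupRep π : Matrix (Fin 2) (Fin 2) J.carrier →ₗ[ℂ]
          Module.End ℂ ((E.carrier × (E.carrier × B.carrier)) × B.carrier)))).2 ?_ hT
      rintro _ ⟨ξ, _, ⟨_, ⟨⟨φ, ψ⟩, ⟨hφ, hψ⟩, rfl⟩, a, rfl⟩, rfl⟩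
      -- An elementary operator on the doubled module is a 2 × 2 matrix of elementary operators on E
      -- ⊕ B, each of which lies in the range of π.
      have hex : ∀ w, ∀ χ ∈ E.sumSelf.functionals, ∃ x, π x = E.sumSelf.elementary w χ := by
        intro w χ hχ
        have : E.sumSelf.elementary w χ ∈ Set.range π := by
          rw [hrange]; exact Submodule.subset_span ⟨w, χ, hχ, rfl⟩
        exact this
      have hφ' : φ ∘ₗ LinearMap.fst ℂ _ _ + LinearMap.mulLeft ℂ a ∘ₗ LinearMap.snd ℂ _ _
          ∈ E.sumSelf.functionals := ⟨φ, hφ, a, rfl⟩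
      obtain ⟨x₀₀, h₀₀⟩ := hex (ξ.1.1, ξ.2) _ hφ'
      obtain ⟨x₀₁, h₀₁⟩ := hex (ξ.1.1, ξ.2) _ hψ
      obtain ⟨x₁₀, h₁₀⟩ := hex ξ.1.2 _ hφ'
      obtain ⟨x₁₁, h₁₁⟩ := hex ξ.1.2 _ hψ
      refine ⟨!![x₀₀, x₀₁; x₁₀, x₁₁], LinearMap.ext fun ζ => ?_⟩
      ext <;> simp [regroupRep, h₀₀, h₀₁, h₁₀, h₁₁, FunctionalModule.elementary, mul_add] <;> abel
  · intro g m
    have hg : ∀ (m : Matrix (Fin 2) (Fin 2) J.carrier) r s,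
        π ((J.mat2.act.toFun g m) r s) = E.sumSelf.act g ∘ₗ π (m r s) ∘ₗ E.sumSelf.act g⁻¹ :=
      fun m r s => hequiv g (m r s)
    refine LinearMap.ext fun ζ => ?_
    ext <;> simp [regroupRep, hg]
  · intro b ξ b'
    change regroupRep π (Matrix.single 0 0 (e.toHom b)) (ξ, b') = _
    rw [regroupRep_single]
    simp [regroupIncl, regroupProj, hcorner]

/-! ### Ideals and conjugation -/

/-- The embedding of a two-sided ideal. -/
structure IsIdealEmbedding {I R : Type*} [NonUnitalRing I] [Module ℂ I] [NonUnitalRing R]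
    [Module ℂ R] (ι : I →ₙₐ[ℂ] R) : Prop where
  injective : Function.Injective ι
  mul_mem : ∀ x j, ∃ k, ι k = x * ι j
  mem_mul : ∀ x j, ∃ k, ι k = ι j * x

theorem mat2Map_apply {A B : Type u} [NonUnitalRing A] [Module ℂ A] [NonUnitalRing B]
    [Module ℂ B] (φ : A →ₙₐ[ℂ] B) (m : Matrix (Fin 2) (Fin 2) A) (a b : Fin 2) :
    mat2Map φ m a b = φ (m a b) := rfl

theorem mat2Map_injective {A B : Type u} [NonUnitalRing A] [Module ℂ A] [NonUnitalRing B]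
    [Module ℂ B] {φ : A →ₙₐ[ℂ] B} (hφ : Function.Injective φ) :
    Function.Injective (mat2Map φ) := fun m n h => by
  ext a b
  exact hφ (congrFun (congrFun h a) b)

namespace IsIdealEmbedding

theorem mat2 {I R : Type u} [NonUnitalRing I] [Module ℂ I] [NonUnitalRing R] [Module ℂ R]
    {ι : I →ₙₐ[ℂ] R} (h : IsIdealEmbedding ι) : IsIdealEmbedding (mat2Map ι) where
  injective := mat2Map_injective h.injective
  mul_mem x j := by
    choose k hk using h.mul_mem
    refine ⟨fun a b => k (x a 0) (j 0 b) + k (x a 1) (j 1 b), ?_⟩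
    ext a b
    change ι (k (x a 0) (j 0 b) + k (x a 1) (j 1 b)) = _
    rw [map_add, hk, hk, Matrix.mul_apply, Fin.sum_univ_two]
    rfl
  mem_mul x j := by
    choose k hk using h.mem_mul
    refine ⟨fun a b => k (x 0 b) (j a 0) + k (x 1 b) (j a 1), ?_⟩
    ext a b
    change ι (k (x 0 b) (j a 0) + k (x 1 b) (j a 1)) = _
    rw [map_add, hk, hk, Matrix.mul_apply, Fin.sum_univ_two]
    rfl

/-- The adjoined scalars only rescale the ideal, so it stays an ideal in R⁺. -/
theorem unitization {I R : Type u} [NonUnitalRing I] [Module ℂ I] [NonUnitalRing R] [Module ℂ R]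
    [IsScalarTower ℂ R R] [SMulCommClass ℂ R R] {ι : I →ₙₐ[ℂ] R} (h : IsIdealEmbedding ι) :
    IsIdealEmbedding ((Unitization.inrNonUnitalAlgHom ℂ R).comp ι) where
  injective := Unitization.inr_injective.comp h.injective
  mul_mem x j := by
    obtain ⟨k, hk⟩ := h.mul_mem x.snd j
    refine ⟨x.fst • j + k, ?_⟩
    ext <;> simp [hk]
  mem_mul x j := by
    obtain ⟨k, hk⟩ := h.mem_mul x.snd j
    refine ⟨x.fst • j + k, ?_⟩
    ext <;> simp [hk]

section Sandwich

variable {I R : Type*} [NonUnitalRing I] [Module ℂ I] [Ring R] [Algebra ℂ R]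
  {ι : I →ₙₐ[ℂ] R} (h : IsIdealEmbedding ι)

/-- The map `x ↦ a x b` on the ideal. -/
def sandwich (a b : R) : I →ₗ[ℂ] I :=
  liftLin (ι : I →ₗ[ℂ] R) h.injective (LinearMap.mulLeftRight ℂ (a, b) ∘ₗ (ι : I →ₗ[ℂ] R))
    fun x => by
      obtain ⟨y, hy⟩ := h.mul_mem a x
      obtain ⟨z, hz⟩ := h.mem_mul b y
      exact ⟨z, by simp [hz, hy]⟩

theorem sandwich_apply (a b : R) (x : I) : ι (h.sandwich a b x) = a * ι x * b := by
  refine (liftLin_apply (ι : I →ₗ[ℂ] R) _ _ _ x).trans ?_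
  simp

/-- The endomorphism `x ↦ a x b` of the ideal, for `b a = 1`. -/
def conj (a b : R) (hab : b * a = 1) : I →ₙₐ[ℂ] I where
  toFun := h.sandwich a b
  map_smul' c x := map_smul _ c x
  map_zero' := map_zero _
  map_add' x y := map_add _ x y
  map_mul' x y := h.injective <| by
    simp only [map_mul, sandwich_apply]
    calc a * (ι x * ι y) * b = a * ι x * 1 * ι y * b := by noncomm_ring
      _ = _ := by rw [← hab]; noncomm_ring

theorem conj_apply (a b : R) (hab : b * a = 1) (x : I) :
    ι (h.conj a b hab x) = a * ι x * b := h.sandwich_apply a b x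

end Sandwich

end IsIdealEmbedding

/-! ### Evaluation of paths -/

theorem IntervalFun.ext_eval {f : IntervalFun} (h : ∀ t, IntervalFun.eval t f = 0) : f = 0 :=
  DFunLike.ext (F := C(unitInterval, ℂ)) f 0 h

theorem evalAt_tmul (A : GAlg.{v, u} G) (t : unitInterval) (a : A.carrier) (f : IntervalFun) :
    evalAt A t (a ⊗ₜ f) = IntervalFun.eval t f • a := by
  simp [evalAt]

theorem evalAt_mul (A : GAlg.{v, u} G) (t : unitInterval) (x y : A.carrier ⊗[ℂ] IntervalFun) :
    evalAt A t (x * y) = evalAt A t x * evalAt A t y := by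
  induction x using TensorProduct.induction_on with
  | zero => simp
  | add x x' hx hx' => rw [add_mul, map_add, map_add, add_mul, hx, hx']
  | tmul a f =>
    induction y using TensorProduct.induction_on with
    | zero => simp
    | add y y' hy hy' => rw [mul_add, map_add, map_add, mul_add, hy, hy']
    | tmul b g =>
      simp [evalAt_tmul, smul_mul_assoc, mul_smul_comm, smul_smul, mul_comm]

theorem evalAt_act (A : GAlg.{v, u} G) (t : unitInterval) (g : G)
    (x : A.carrier ⊗[ℂ] IntervalFun) :
    evalAt A t (A.path.act.toFun g x) = A.act.toFun g (evalAt A t x) := by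
  change evalAt A t (LinearMap.rTensor IntervalFun
    ((A.act.toFun g : A.carrier →ₙₐ[ℂ] A.carrier) : A.carrier →ₗ[ℂ] A.carrier) x) = _
  induction x using TensorProduct.induction_on with
  | zero => simp
  | add x x' hx hx' => rw [map_add, map_add, map_add, map_add, hx, hx']
  | tmul a f => simp [evalAt_tmul]

/-- An element of `A ⊗ C([0,1])` is determined by its values. -/
theorem evalAt_ext (A : GAlg.{v, u} G) {x y : A.carrier ⊗[ℂ] IntervalFun}
    (h : ∀ t, evalAt A t x = evalAt A t y) : x = y := by
  classical
  -- The tensor product is algebraic: in a linear basis of A, an element has finitely many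
  -- coefficient functions, whose values are the coordinates of its evaluations.
  let b := Module.Basis.ofVectorSpace ℂ A.carrier
  let e := TensorProduct.equivFinsuppOfBasisLeft (N := IntervalFun) b
  have key : ∀ z i t, IntervalFun.eval t (e z i) = b.repr (evalAt A t z) i := by
    intro z i t
    induction z using TensorProduct.induction_on with
    | zero => simp
    | add x x' hx hx' => simp [hx, hx']
    | tmul a f => simp [e, evalAt_tmul, mul_comm]
  refine e.injective (Finsupp.ext fun i => sub_eq_zero.1 (IntervalFun.ext_eval fun t => ?_))
  rw [map_sub, key, key, h, sub_self]

/-- Conjugations on an ideal by a path of invertible elements, that is an algebraic combination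
of invariant elements, are homotopic. -/
theorem conj_homotopy {N : GAlg.{v, u} G} {R : Type u} [Ring R] [Algebra ℂ R]
    {ι : N.carrier →ₙₐ[ℂ] R} (h : IsIdealEmbedding ι) (γ : G → R →ₙₐ[ℂ] R)
    (hγ : ∀ g x, ι (N.act.toFun g x) = γ g (ι x)) {n : ℕ} (A B : Fin n → R)
    (hA : ∀ g i, γ g (A i) = A i) (hB : ∀ g i, γ g (B i) = B i) (r : Fin n → IntervalFun)
    (hAB : ∀ t, (∑ i, IntervalFun.eval t (r i) • B i) * (∑ i, IntervalFun.eval t (r i) • A i) = 1)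
    (φ₀ φ₁ : GHom N N)
    (h₀ : ∀ x, ι (φ₀.toHom x) = (∑ i, IntervalFun.eval 0 (r i) • A i) * ι x *
      (∑ i, IntervalFun.eval 0 (r i) • B i))
    (h₁ : ∀ x, ι (φ₁.toHom x) = (∑ i, IntervalFun.eval 1 (r i) • A i) * ι x *
      (∑ i, IntervalFun.eval 1 (r i) • B i)) :
    φ₀.mor = φ₁.mor := by
  -- The path x ↦ W_t x W'_t is the finite sum of the terms A_i x B_j ⊗ r_i r_j. Finiteness places
  -- it in the algebraic tensor product, where continuity of the path alone would not suffice.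
  let L : N.carrier →ₗ[ℂ] N.carrier ⊗[ℂ] IntervalFun :=
    ∑ i, ∑ j, (TensorProduct.mk ℂ N.carrier IntervalFun).flip (r i * r j) ∘ₗ h.sandwich (A i) (B j)
  have hL : ∀ t x, ι (evalAt N t (L x)) = (∑ i, IntervalFun.eval t (r i) • A i) * ι x *
      (∑ i, IntervalFun.eval t (r i) • B i) := by
    intro t x
    simp only [L, LinearMap.sum_apply, LinearMap.comp_apply, LinearMap.flip_apply,
      TensorProduct.mk_apply, map_sum, evalAt_tmul, map_smul, h.sandwich_apply, Finset.sum_mul,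
      Finset.mul_sum, map_mul]
    rw [Finset.sum_comm]
    refine Finset.sum_congr rfl fun i _ => Finset.sum_congr rfl fun j _ => ?_
    simp only [smul_mul_assoc, mul_smul_comm, smul_smul, mul_comm]
  let Φ : N.carrier →ₙₐ[ℂ] N.carrier ⊗[ℂ] IntervalFun :=
    { toFun := L
      map_smul' := fun c x => map_smul L c x
      map_zero' := map_zero L
      map_add' := map_add L
      -- Identities of paths are checked at each time t, and there inside R, where W'_t W_t = 1 can
      -- be inserted.
      map_mul' := fun x y => evalAt_ext N fun t => h.injective <| by
        rw [evalAt_mul, hL, map_mul ι, map_mul ι, hL, hL]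
        set W := ∑ i, IntervalFun.eval t (r i) • A i
        set W' := ∑ i, IntervalFun.eval t (r i) • B i
        have hW : W' * W = 1 := hAB t
        calc W * (ι x * ι y) * W' = W * ι x * 1 * ι y * W' := by noncomm_ring
          _ = _ := by rw [← hW]; noncomm_ring }
  have hγs : ∀ g t (C : Fin n → R), (∀ i, γ g (C i) = C i) →
      γ g (∑ i, IntervalFun.eval t (r i) • C i) = ∑ i, IntervalFun.eval t (r i) • C i := by
    intro g t C hC
    simp [map_sum, hC]
  let Ψ : GHom N N.path := ⟨Φ, fun g x => evalAt_ext N fun t => h.injective <| by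
    rw [evalAt_act, hγ]
    change ι (evalAt N t (L _)) = γ g (ι (evalAt N t (L x)))
    rw [hL, hL, map_mul, map_mul, hγs g t A (hA g), hγs g t B (hB g), hγ]⟩
  refine Quotient.sound (Rel.homotopy Ψ φ₀ φ₁ (fun a => h.injective ?_) fun a => h.injective ?_)
  · rw [h₀]; exact (hL 0 a).symm
  · rw [h₁]; exact (hL 1 a).symm

/-! ### The rotation -/

theorem rotation_eq {R : Type u} [Ring R] [Algebra ℂ R] (p : R) (t : ℝ) :
    rotation p t = !![(Real.cos t : ℂ) • p + (1 - p), (Real.sin t : ℂ) • p;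
      -((Real.sin t : ℂ) • p), (Real.cos t : ℂ) • p + (1 - p)] := by
  ext a b
  fin_cases a <;> fin_cases b <;> simp [rotation]

/-- On the range of p this is the usual inversion of a plane rotation, on the range of 1 - p both
factors are the identity, and the mixed terms vanish. -/
theorem rotation_mul_neg {R : Type u} [Ring R] [Algebra ℂ R] {p : R} (hp : p * p = p) (t : ℝ) :
    rotation p t * rotation p (-t) = 1 := by
  have h1 : ((Real.cos t : ℂ)) * Real.cos t + Real.sin t * Real.sin t = 1 := by
    rw [← Complex.ofReal_mul, ← Complex.ofReal_mul, ← Complex.ofReal_add, ← sq, ← sq,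
      Real.cos_sq_add_sin_sq, Complex.ofReal_one]
  have hp1 : p * (1 - p) = 0 := by rw [mul_sub, hp, mul_one, sub_self]
  have hp2 : (1 - p) * p = 0 := by rw [sub_mul, hp, one_mul, sub_self]
  have hp3 : (1 - p) * (1 - p) = 1 - p := by rw [mul_sub, hp2, mul_one, sub_zero]
  generalize hq : 1 - p = q at hp1 hp2 hp3
  have hpq : p + q = 1 := by rw [← hq]; abel
  rw [rotation_eq, rotation_eq, Real.cos_neg, Real.sin_neg, hq]
  generalize (Real.cos t : ℂ) = c at *
  rw [Complex.ofReal_neg]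
  generalize (Real.sin t : ℂ) = s at *
  have e1 : (c • p + q) * (c • p + q) = (c * c) • p + q := by
    simp [mul_add, add_mul, smul_smul, hp, hp1, hp2, hp3]
  have e2 : (c • p + q) * (s • p) = (c * s) • p := by
    simp [add_mul, smul_smul, hp, hp2, mul_comm]
  have e3 : (s • p) * (c • p + q) = (c * s) • p := by
    simp [mul_add, smul_smul, hp, hp1]
  have e4 : (s • p) * (s • p) = (s * s) • p := by
    simp [smul_smul, hp]
  have e5 : (c * c) • p + q + (s * s) • p = 1 := by
    rw [add_right_comm, ← add_smul, h1, one_smul, hpq]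
  rw [Matrix.mul_fin_two, Matrix.one_fin_two]
  simp only [neg_smul, neg_neg, mul_neg, neg_mul, e1, e2, e3, e4, e5, neg_add_cancel]
  rw [add_comm ((s * s) • p), e5]

theorem rotation_zero {R : Type u} [Ring R] [Algebra ℂ R] (p : R) : rotation p 0 = 1 := by
  rw [rotation_eq]
  ext a b
  fin_cases a <;> fin_cases b <;> simp

theorem rotation_pi_div_two {R : Type u} [Ring R] [Algebra ℂ R] (p : R) :
    rotation p (Real.pi / 2) = !![1 - p, p; -p, 1 - p] := by
  rw [rotation_eq]; simp

theorem rotation_neg_pi_div_two {R : Type u} [Ring R] [Algebra ℂ R] (p : R) :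
    rotation p (-(Real.pi / 2)) = !![1 - p, -p; p, 1 - p] := by
  rw [rotation_eq]; simp

/-! ### Left multiplication on the ideal J, and the degree of elements of M -/

namespace DoubleSplit

section General

variable {A X J : GAlg.{v, u} G} (D : DoubleSplit A X J)

theorem isIdealEmbedding : IsIdealEmbedding D.i.toHom := ⟨D.i_injective, D.mul_mem, D.mem_mul⟩

/-- The embedding of `J` into `X⁺`. -/
def incl : J.carrier →ₙₐ[ℂ] Unitization ℂ X.carrier :=
  (Unitization.inrNonUnitalAlgHom ℂ X.carrier).comp D.i.toHom

theorem incl_apply (j : J.carrier) : D.incl j = Unitization.inr (D.i.toHom j) := rfl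

theorem isIdealEmbedding_incl : IsIdealEmbedding D.incl := D.isIdealEmbedding.unitization

/-- The representation of `X⁺` on its ideal `J` by left multiplication. -/
def left : Unitization ℂ X.carrier →ₐ[ℂ] Module.End ℂ J.carrier :=
  AlgHom.ofLinearMap
    { toFun := fun x => D.isIdealEmbedding_incl.sandwich x 1
      map_add' := fun x y => LinearMap.ext fun j => D.isIdealEmbedding_incl.injective <| by
        simp [IsIdealEmbedding.sandwich_apply, add_mul]
      map_smul' := fun c x => LinearMap.ext fun j => D.isIdealEmbedding_incl.injective <| by
        simp [IsIdealEmbedding.sandwich_apply] }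
    (LinearMap.ext fun j => D.isIdealEmbedding_incl.injective <| by
      simp [IsIdealEmbedding.sandwich_apply])
    fun x y => LinearMap.ext fun j => D.isIdealEmbedding_incl.injective <| by
      simp [IsIdealEmbedding.sandwich_apply, mul_assoc]

theorem incl_left (x : Unitization ℂ X.carrier) (j : J.carrier) :
    D.incl (D.left x j) = x * D.incl j := by
  refine (D.isIdealEmbedding_incl.sandwich_apply x 1 j).trans (mul_one _)

theorem left_incl (j k : J.carrier) : D.left (D.incl j) k = j * k :=
  D.isIdealEmbedding_incl.injective <| by rw [incl_left, map_mul]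

theorem left_act (g : G) (x : Unitization ℂ X.carrier) (j : J.carrier) :
    D.left (unitizationMap (X.act.toFun g) x) (J.act.toFun g j) = J.act.toFun g (D.left x j) := by
  have h : ∀ k, D.incl (J.act.toFun g k) = unitizationMap (X.act.toFun g) (D.incl k) := fun k => by
    rw [incl_apply, D.i.equivariant, incl_apply, unitizationMap_apply]; simp
  refine D.isIdealEmbedding_incl.injective ?_
  rw [incl_left, h, h, incl_left, map_mul]

theorem inclM_injective : Function.Injective D.inclM := fun _ _ h =>
  D.i_injective (congrArg (fun m : D.M => m.1.1) h)

/-- The representation of `M` on `J`. -/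
def leftM (m : D.M) : Module.End ℂ J.carrier := D.left (Unitization.inr m.1.1)

theorem inclM_leftM (m : D.M) (j : J.carrier) : D.inclM (D.leftM m j) = m * D.inclM j := by
  have h := D.incl_left (Unitization.inr m.1.1) j
  rw [incl_apply, incl_apply, ← Unitization.inr_mul] at h
  refine Subtype.ext (Prod.ext (Unitization.inr_injective h) ?_)
  exact (mul_zero m.1.2).symm

theorem leftM_inclM (j : J.carrier) : D.leftM (D.inclM j) = D.left (D.incl j) := rfl

end General

variable {X J : GAlg.{v, u} G} (D : DoubleSplit (scalars G) X J)

/-- The projection of `M` onto the scalars. -/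
def deg : D.M →ₙₐ[ℂ] ℂ where
  toFun m := ULift.down m.1.2
  map_smul' _ _ := rfl
  map_zero' := rfl
  map_add' _ _ := rfl
  map_mul' _ _ := rfl

theorem deg_inclM (j : J.carrier) : D.deg (D.inclM j) = 0 := rfl

/-- The idempotent `(s₋ ⊕ id)(1)` of `M`. -/
def unitM : D.M := D.sMinusM ⟨1⟩

theorem deg_unitM : D.deg D.unitM = 1 := rfl

theorem unitM_mul_unitM : D.unitM * D.unitM = D.unitM := by
  rw [unitM, ← map_mul]
  congr 1
  exact ULift.ext _ _ (mul_one 1)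

theorem sMinusM_eq (l : ℂ) : D.sMinusM ⟨l⟩ = l • D.unitM := by
  rw [unitM, ← map_smul]
  congr 1
  exact ULift.ext _ _ (mul_one l).symm

theorem exists_inclM {m : D.M} (h : D.deg m = 0) : ∃ j, D.inclM j = m :=
  (D.splitExact.exact m).1 (ULift.ext _ _ h)

/-- This is where the source ℂ enters: M is J plus a line, so linear maps on M are controlled by J
and one idempotent. -/
theorem exists_eq_add (m : D.M) : ∃ j, m = D.inclM j + D.deg m • D.unitM := by
  obtain ⟨j, hj⟩ := D.exists_inclM (m := m - D.deg m • D.unitM) (by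
    rw [map_sub, map_smul, deg_unitM]; simp)
  exact ⟨j, by rw [hj]; abel⟩

/-- The idempotent `p = s₋(1)` in `X⁺`. -/
def proj : Unitization ℂ X.carrier := Unitization.inr (D.sMinus.toHom ⟨1⟩)

theorem leftM_unitM : D.leftM D.unitM = D.left D.proj := rfl

theorem proj_mul_proj : D.proj * D.proj = D.proj :=
  (Unitization.inr_mul ℂ _ _).symm.trans <| congrArg (fun m : D.M => (Unitization.inr m.1.1 : Unitization ℂ X.carrier)) D.unitM_mul_unitM

theorem act_proj (g : G) : unitizationMap (X.act.toFun g) D.proj = D.proj := by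
  have := D.sMinus.equivariant g ⟨1⟩
  rw [unitizationMap_apply]
  simp only [proj, Unitization.fst_inr, Unitization.inl_zero, zero_add, Unitization.snd_inr]
  rw [← this]
  rfl

end DoubleSplit

/-! ### Scalars and representations of G extracted from the M₂-action -/

namespace LevelOne

variable {B X J : GAlg.{v, u} G} (D : LevelOne (scalars G) B X J)

theorem δ_single_zero (g : G) (m : D.M) :
    D.δ.toFun g (Matrix.single 0 0 m) = Matrix.single 0 0 (D.minusAct.toFun g m) := by
  have := D.f₁.equivariant g m
  rw [D.f₁_apply, D.f₁_apply] at this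
  exact this.symm

theorem δ_single_one (g : G) (m : D.M) :
    D.δ.toFun g (Matrix.single 1 1 m) = Matrix.single 1 1 (D.plusAct.toFun g m) := by
  have := D.f₂.equivariant g m
  rw [D.f₂_apply, D.f₂_apply] at this
  exact this.symm

theorem isDiagonal_δ : D.δ.IsDiagonal := by
  intro g k m
  match k with
  | 0 => exact ⟨_, D.δ_single_zero g m⟩
  | 1 => exact ⟨_, D.δ_single_one g m⟩

theorem entry_zero (g : G) (m : D.M) : D.δ.entry g 0 0 m = D.minusAct.toFun g m := by
  change D.δ.toFun g (Matrix.single 0 0 m) 0 0 = _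
  rw [δ_single_zero]; simp

theorem entry_one (g : G) (m : D.M) : D.δ.entry g 1 1 m = D.plusAct.toFun g m := by
  change D.δ.toFun g (Matrix.single 1 1 m) 1 1 = _
  rw [δ_single_one]; simp

theorem entry_mul (g : G) (a b c : Fin 2) (m n : D.M) :
    D.δ.entry g a c (m * n) = D.δ.entry g a b m * D.δ.entry g b c n :=
  D.isDiagonal_δ.entry_mul D.quadratik_M g a b c m n

theorem entry_entry (g h : G) (a b : Fin 2) (m : D.M) :
    D.δ.entry (g * h) a b m = D.δ.entry g a b (D.δ.entry h a b m) :=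
  D.isDiagonal_δ.entry_entry D.quadratik_M g h a b m

/-- The projections of M₋ and M₊ onto ℂ are both equivariant, and G acts trivially on ℂ. -/
theorem deg_entry_diag (g : G) (a : Fin 2) (m : D.M) : D.deg (D.δ.entry g a a m) = D.deg m := by
  match a with
  | 0 => rw [entry_zero]; rfl
  | 1 => rw [entry_one]; exact congrArg ULift.down (D.projM_plusAct g m)

/-- Nothing is assumed about the off-diagonal entries. On a product xy, however, the factor y passes
through a diagonal entry, which preserves degree zero; as J is quadratik, every entry maps J into J.
-/
theorem deg_entry_inclM (g : G) (a b : Fin 2) (j : J.carrier) :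
    D.deg (D.δ.entry g a b (D.inclM j)) = 0 := by
  induction j using J.quadratik.induction with
  | mul x y =>
    rw [map_mul, D.entry_mul g a b b, map_mul, deg_entry_diag, D.deg_inclM, mul_zero]
  | zero => simp
  | add x y hx hy => rw [map_add, map_add, map_add, hx, hy, add_zero]
  | smul c x hx => rw [map_smul, map_smul, map_smul, hx, smul_zero]

/-- The cocycle, by which the entries of the `M₂`-action act on the quotient `M / J`. -/
def char (g : G) (a b : Fin 2) : ℂ := D.deg (D.δ.entry g a b D.unitM)

theorem deg_entry (g : G) (a b : Fin 2) (m : D.M) :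
    D.deg (D.δ.entry g a b m) = D.char g a b * D.deg m := by
  obtain ⟨j, hj⟩ := D.exists_eq_add m
  conv_lhs => rw [hj]
  rw [map_add, map_add, deg_entry_inclM, map_smul, map_smul, zero_add, char, smul_eq_mul, mul_comm]

theorem char_one (a b : Fin 2) : D.char 1 a b = 1 := by
  rw [char, GAction.entry_one, D.deg_unitM]

theorem char_mul (g h : G) (a b : Fin 2) : D.char (g * h) a b = D.char g a b * D.char h a b := by
  rw [char, entry_entry, deg_entry]; rfl

theorem char_diag (g : G) (a : Fin 2) : D.char g a a = 1 := by
  rw [char, deg_entry_diag, D.deg_unitM]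

theorem char_mul_char (g : G) (a b c : Fin 2) :
    D.char g a b * D.char g b c = D.char g a c := by
  conv_rhs => rw [char, ← D.unitM_mul_unitM, D.entry_mul g a b c, map_mul]
  rfl

/-- The scalar at (a, b) is a quotient of scalars of the first column. Multiplying by g with index a
on the left and by g⁻¹ with index b on the right thus yields `char g a b`. -/
theorem char_mul_char_inv (g : G) (a b : Fin 2) :
    D.char g a 0 * D.char g⁻¹ b 0 = D.char g a b := by
  rw [← D.char_mul_char g a b 0, mul_assoc, ← char_mul, mul_inv_cancel, char_one, mul_one]

/-- The representation of `G` on `J`, that is given by the first column of the `M₂`-action. -/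
def repLin (a : Fin 2) (g : G) : Module.End ℂ J.carrier :=
  liftLin (D.inclM : J.carrier →ₗ[ℂ] D.M) D.inclM_injective
    (D.δ.entry g a 0 ∘ₗ (D.inclM : J.carrier →ₗ[ℂ] D.M))
    fun j => D.exists_inclM (D.deg_entry_inclM g a 0 j)

theorem inclM_repLin (a : Fin 2) (g : G) (j : J.carrier) :
    D.inclM (D.repLin a g j) = D.δ.entry g a 0 (D.inclM j) :=
  liftLin_apply (D.inclM : J.carrier →ₗ[ℂ] D.M) _ _ _ j

/-- `repLin` as a homomorphism of monoids. -/
def rep (a : Fin 2) : G →* Module.End ℂ J.carrier where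
  toFun := D.repLin a
  map_one' := LinearMap.ext fun j => D.inclM_injective <| by
    rw [inclM_repLin, GAction.entry_one]; rfl
  map_mul' g h := LinearMap.ext fun j => D.inclM_injective <| by
    rw [inclM_repLin, Module.End.mul_apply, inclM_repLin, inclM_repLin, entry_entry]

theorem inclM_rep (a : Fin 2) (g : G) (j : J.carrier) :
    D.inclM (D.rep a g j) = D.δ.entry g a 0 (D.inclM j) :=
  D.inclM_repLin a g j

theorem rep_zero (g : G) (j : J.carrier) : D.rep 0 g j = J.act.toFun g j :=
  D.inclM_injective <| by
    rw [inclM_rep, entry_zero]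
    exact (D.splitExact.i.equivariant g j).symm

theorem rep_mul_inv (a : Fin 2) (g : G) : D.rep a g * D.rep a g⁻¹ = 1 := by
  rw [← map_mul, mul_inv_cancel, map_one]

/-- This is the entry rule for a product m·j with j in J, read in column 0. It makes the entries of
the M₂-action inner in End(J). -/
theorem rep_mul_leftM (g : G) (a b : Fin 2) (m : D.M) :
    D.rep a g * D.leftM m * D.rep b g⁻¹ = D.leftM (D.δ.entry g a b m) := by
  have h : D.rep a g * D.leftM m = D.leftM (D.δ.entry g a b m) * D.rep b g :=
    LinearMap.ext fun j => D.inclM_injective <| by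
      simp only [Module.End.mul_apply]
      rw [inclM_rep, D.inclM_leftM, D.inclM_leftM, inclM_rep, D.entry_mul g a b 0]
  rw [h, mul_assoc, rep_mul_inv, mul_one]

/-- The algebra, in which the algebra `M` of the rotated morphism is represented. -/
abbrev Ambient (J : GAlg.{v, u} G) : Type u := Matrix (Fin 2) (Fin 2) (Module.End ℂ J.carrier) × ℂ

/-- The representation of `G` in the ambient algebra, which implements the two actions. -/
def ambientRep (a : Fin 2) : G →* Ambient J where
  -- The second copy of J carries the original action for both values of a, rescaled by `char g a
  -- 0`. In this way the entry λp^⊥ acquires the same factor as λp modulo J and as the component in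
  -- ℂ.
  toFun g := (!![D.rep a g, 0; 0, D.char g a 0 • D.rep 0 g], D.char g a 0)
  map_one' := by
    rw [map_one, map_one, char_one, one_smul, ← Matrix.one_fin_two]; rfl
  map_mul' g h := by
    rw [map_mul, map_mul, char_mul]
    ext1
    · simp [smul_smul]
    · rfl

/-- The general element of the represented algebra. -/
def ambientElem (x : Matrix (Fin 2) (Fin 2) J.carrier) (l : ℂ) : Ambient J :=
  (D.left.mapMatrix (mat2Map D.incl x + l • !![D.proj, 0; 0, 1 - D.proj]), l)

theorem ambientElem_fst (x : Matrix (Fin 2) (Fin 2) J.carrier) (l : ℂ) :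
    (D.ambientElem x l).1 = !![D.left (D.incl (x 0 0)) + l • D.left D.proj, D.left (D.incl (x 0 1));
      D.left (D.incl (x 1 0)), D.left (D.incl (x 1 1)) + l • (1 - D.left D.proj)] := by
  ext1 a b
  fin_cases a <;> fin_cases b <;> simp [ambientElem, mat2Map_apply]

/-- The represented algebra is invariant under the implemented actions. -/
theorem exists_ambientElem_conj (g : G) (a b : Fin 2) (x : Matrix (Fin 2) (Fin 2) J.carrier)
    (l : ℂ) : ∃ y, D.ambientRep a g * D.ambientElem x l * D.ambientRep b g⁻¹
      = D.ambientElem y (D.char g a b * l) := by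
  -- The upper left entry comes from an element of M of degree l. Its transform has degree `char g a
  -- b * l`, and the excess over this multiple of the idempotent lies in J.
  have h₀₀ : ∃ y, D.inclM y = D.δ.entry g a b (D.inclM (x 0 0) + l • D.unitM)
      - (D.char g a b * l) • D.unitM := D.exists_inclM <| by
    rw [map_sub, deg_entry, map_add, D.deg_inclM, map_smul, map_smul, D.deg_unitM]; simp
  obtain ⟨y₀₀, h₀₀⟩ := h₀₀
  obtain ⟨y₀₁, h₀₁⟩ := D.exists_inclM (D.deg_entry_inclM g a 0 (x 0 1))
  obtain ⟨y₁₀, h₁₀⟩ := D.exists_inclM (D.deg_entry_inclM g 0 b (x 1 0))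
  obtain ⟨y₁₁, h₁₁⟩ := D.exists_inclM (D.deg_entry_inclM g 0 0 (x 1 1))
  have hadd : ∀ m n : D.M, D.leftM (m + n) = D.leftM m + D.leftM n := fun m n => by
    simp [DoubleSplit.leftM]
  have hsmul : ∀ (c : ℂ) (m : D.M), D.leftM (c • m) = c • D.leftM m := fun m n => by
    simp [DoubleSplit.leftM]
  have e₀₀ : D.rep a g * (D.left (D.incl (x 0 0)) + l • D.left D.proj) * D.rep b g⁻¹
      = D.left (D.incl y₀₀) + (D.char g a b * l) • D.left D.proj := by
    rw [← D.leftM_inclM, ← D.leftM_unitM, ← hsmul, ← hadd, rep_mul_leftM, ← D.leftM_inclM, h₀₀,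
      ← hsmul, ← hadd, sub_add_cancel]
  have e₀₁ : D.rep a g * D.left (D.incl (x 0 1)) * D.rep 0 g⁻¹ = D.left (D.incl y₀₁) := by
    rw [← D.leftM_inclM, rep_mul_leftM, ← D.leftM_inclM, h₀₁]
  have e₁₀ : D.rep 0 g * D.left (D.incl (x 1 0)) * D.rep b g⁻¹ = D.left (D.incl y₁₀) := by
    rw [← D.leftM_inclM, rep_mul_leftM, ← D.leftM_inclM, h₁₀]
  have hunit : D.δ.entry g 0 0 D.unitM = D.unitM := by
    rw [entry_zero]
    exact (D.splitExact.s.equivariant g ⟨1⟩).symm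
  have e₁₁ : D.rep 0 g * (D.left (D.incl (x 1 1)) + l • (1 - D.left D.proj)) * D.rep 0 g⁻¹
      = D.left (D.incl y₁₁) + l • (1 - D.left D.proj) := by
    rw [mul_add, add_mul, ← D.leftM_inclM, rep_mul_leftM, ← D.leftM_inclM, h₁₁, mul_smul_comm,
      smul_mul_assoc, mul_sub, sub_mul, mul_one, rep_mul_inv, ← D.leftM_unitM, rep_mul_leftM, hunit]
  have hc : D.char g⁻¹ b 0 * (D.char g a 0 * l) = D.char g a b * l := by
    rw [← D.char_mul_char_inv g a b]; ring
  -- The rescaling of the second copy of J contributes one scalar to each off-diagonal position and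
  -- both scalars, whose product is `char g a b`, to the lower right one.
  refine ⟨!![y₀₀, D.char g⁻¹ b 0 • y₀₁; D.char g a 0 • y₁₀, D.char g a b • y₁₁], Prod.ext ?_ ?_⟩
  · have hS : ∀ c k, (D.ambientRep c k).1 = !![D.rep c k, 0; 0, D.char k c 0 • D.rep 0 k] :=
      fun _ _ => rfl
    rw [Prod.fst_mul, Prod.fst_mul, ambientElem_fst, ambientElem_fst, hS, hS, Matrix.mul_fin_two,
      Matrix.mul_fin_two]
    simp only [zero_mul, mul_zero, add_zero, zero_add, mul_smul_comm, smul_mul_assoc, e₀₀, e₀₁,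
      e₁₀, e₁₁, Matrix.of_apply, Matrix.cons_val', Matrix.cons_val_zero, Matrix.cons_val_one,
      Matrix.cons_val_fin_one, map_smul, smul_smul, smul_add]
    rw [hc, mul_comm (D.char g⁻¹ b 0), char_mul_char_inv]
  · change D.char g a 0 * l * D.char g⁻¹ b 0 = D.char g a b * l
    rw [← hc]; ring

end LevelOne

/-! ### Unitizations, and actions implemented by conjugation -/

theorem unitizationMap_inr {A B : Type u} [NonUnitalRing A] [Module ℂ A] [IsScalarTower ℂ A A]
    [SMulCommClass ℂ A A] [NonUnitalRing B] [Module ℂ B] [IsScalarTower ℂ B B]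
    [SMulCommClass ℂ B B] (φ : A →ₙₐ[ℂ] B) (a : A) :
    unitizationMap φ (Unitization.inr a) = Unitization.inr (φ a) := by
  simp [unitizationMap_apply]

theorem unitizationMap_one {A B : Type u} [NonUnitalRing A] [Module ℂ A] [IsScalarTower ℂ A A]
    [SMulCommClass ℂ A A] [NonUnitalRing B] [Module ℂ B] [IsScalarTower ℂ B B]
    [SMulCommClass ℂ B B] (φ : A →ₙₐ[ℂ] B) : unitizationMap φ 1 = 1 := by
  simp [unitizationMap_apply]

theorem unitizationMap_injective {A B : Type u} [NonUnitalRing A] [Module ℂ A]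
    [IsScalarTower ℂ A A] [SMulCommClass ℂ A A] [NonUnitalRing B] [Module ℂ B]
    [IsScalarTower ℂ B B] [SMulCommClass ℂ B B] {φ : A →ₙₐ[ℂ] B} (hφ : Function.Injective φ) :
    Function.Injective (unitizationMap φ) := fun x y h => by
  rw [unitizationMap_apply, unitizationMap_apply] at h
  refine Unitization.ext ?_ (hφ ?_)
  · simpa using congrArg (fun z => z.fst) h
  · simpa using congrArg (fun z => z.snd) h

theorem mat2Map_fin_two {A B : Type u} [NonUnitalRing A] [Module ℂ A] [NonUnitalRing B]
    [Module ℂ B] (φ : A →ₙₐ[ℂ] B) (a b c d : A) :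
    mat2Map φ !![a, b; c, d] = !![φ a, φ b; φ c, φ d] := by
  ext i j
  fin_cases i <;> fin_cases j <;> rfl

/-- The action on an algebra `N`, that is represented on an algebra `R`, by conjugation with a
representation of the group. -/
def conjAct {N : Type u} [NonUnitalRing N] [Module ℂ N] {R : Type*} [Ring R] [Algebra ℂ R]
    (ρ : N →ₙₐ[ℂ] R) (hρ : Function.Injective ρ) (S : G →* R)
    (h : ∀ g n, ∃ n', ρ n' = S g * ρ n * S g⁻¹) : GAction G N where
  toFun g := liftHom ρ hρ
    { toFun := fun n => S g * ρ n * S g⁻¹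
      map_smul' := fun c n => by simp
      map_zero' := by simp
      map_add' := fun m n => by simp [mul_add, add_mul]
      map_mul' := fun m n => by
        have hS : S g⁻¹ * S g = 1 := by rw [← map_mul, inv_mul_cancel, map_one]
        rw [map_mul]
        calc S g * (ρ m * ρ n) * S g⁻¹ = S g * ρ m * 1 * ρ n * S g⁻¹ := by noncomm_ring
          _ = _ := by rw [← hS]; noncomm_ring } (h g)
  one_apply n := hρ <| (liftHom_apply ρ hρ _ (h 1) n).trans <| by
    change S 1 * ρ n * S 1⁻¹ = _
    simp
  mul_apply g k n := hρ <| (liftHom_apply ρ hρ _ (h (g * k)) n).trans <| by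
    refine Eq.trans ?_ (liftHom_apply ρ hρ _ (h g) _).symm
    change S (g * k) * ρ n * S (g * k)⁻¹ = S g * ρ (liftHom ρ hρ _ (h k) n) * S g⁻¹
    rw [liftHom_apply]
    change _ = S g * (S k * ρ n * S k⁻¹) * S g⁻¹
    simp [mul_assoc]

theorem conjAct_apply {N : Type u} [NonUnitalRing N] [Module ℂ N] {R : Type*} [Ring R]
    [Algebra ℂ R] (ρ : N →ₙₐ[ℂ] R) (hρ : Function.Injective ρ) (S : G →* R)
    (h : ∀ g n, ∃ n', ρ n' = S g * ρ n * S g⁻¹) (g : G) (n : N) :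
    ρ ((conjAct ρ hρ S h).toFun g n) = S g * ρ n * S g⁻¹ :=
  liftHom_apply ρ hρ _ (h g) n

/-! ### The rotation as an automorphism of M₂(J), homotopic to the identity -/

namespace DoubleSplit

variable {X J : GAlg.{v, u} G} (D : DoubleSplit (scalars G) X J)

/-- The rotation `U` by the right angle. -/
def rot : Matrix (Fin 2) (Fin 2) (Unitization ℂ X.carrier) := rotation D.proj (Real.pi / 2)

/-- The inverse of the rotation `U`. -/
def rotInv : Matrix (Fin 2) (Fin 2) (Unitization ℂ X.carrier) := rotation D.proj (-(Real.pi / 2))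

theorem rot_mul_rotInv : D.rot * D.rotInv = 1 := rotation_mul_neg D.proj_mul_proj _

theorem rotInv_mul_rot : D.rotInv * D.rot = 1 := by
  have := rotation_mul_neg D.proj_mul_proj (-(Real.pi / 2))
  rwa [neg_neg] at this

theorem rot_eq : D.rot = !![1 - D.proj, D.proj; -D.proj, 1 - D.proj] := rotation_pi_div_two _

theorem rotInv_eq : D.rotInv = !![1 - D.proj, -D.proj; D.proj, 1 - D.proj] :=
  rotation_neg_pi_div_two _

theorem proj_mul_compl : D.proj * (1 - D.proj) = 0 := by
  rw [mul_sub, proj_mul_proj, mul_one, sub_self]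

theorem compl_mul_proj : (1 - D.proj) * D.proj = 0 := by
  rw [sub_mul, proj_mul_proj, one_mul, sub_self]

theorem compl_mul_compl : (1 - D.proj) * (1 - D.proj) = 1 - D.proj := by
  rw [mul_sub, compl_mul_proj, mul_one, sub_zero]

/-- The rotation of the idempotent `p ⊕ p^⊥` is `0 ⊕ 1`. -/
theorem rot_conj_diag : D.rot * !![D.proj, 0; 0, 1 - D.proj] * D.rotInv = !![0, 0; 0, 1] := by
  rw [rot_eq, rotInv_eq, Matrix.mul_fin_two, Matrix.mul_fin_two]
  simp only [mul_zero, add_zero, zero_add, compl_mul_proj, proj_mul_compl, compl_mul_compl,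
    zero_mul, neg_mul, mul_neg, proj_mul_proj, neg_zero, neg_neg]
  rw [add_sub_cancel]

/-- The action of `g` on `M₂(X⁺)`. -/
def matAct (_D : DoubleSplit (scalars G) X J) (g : G) :
    Matrix (Fin 2) (Fin 2) (Unitization ℂ X.carrier) →ₙₐ[ℂ]
      Matrix (Fin 2) (Fin 2) (Unitization ℂ X.carrier) :=
  mat2Map (unitizationMap (X.act.toFun g))

theorem incl_act (g : G) (j : J.carrier) :
    D.incl (J.act.toFun g j) = unitizationMap (X.act.toFun g) (D.incl j) := by
  rw [incl_apply, D.i.equivariant, incl_apply, unitizationMap_inr]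

theorem mat2Map_incl_act (g : G) (x : Matrix (Fin 2) (Fin 2) J.carrier) :
    mat2Map D.incl (J.mat2.act.toFun g x) = D.matAct g (mat2Map D.incl x) := by
  ext1 a b
  exact D.incl_act g (x a b)

theorem act_compl (g : G) :
    unitizationMap (X.act.toFun g) (1 - D.proj) = 1 - D.proj := by
  rw [map_sub, unitizationMap_one, act_proj]

theorem matAct_rot (g : G) : D.matAct g D.rot = D.rot := by
  rw [rot_eq, matAct, mat2Map_fin_two, act_compl, map_neg, act_proj]

theorem matAct_rotInv (g : G) : D.matAct g D.rotInv = D.rotInv := by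
  rw [rotInv_eq, matAct, mat2Map_fin_two, act_compl, map_neg, act_proj]

theorem isIdealEmbedding_mat : IsIdealEmbedding (mat2Map D.incl) := D.isIdealEmbedding_incl.mat2

/-- The automorphism `ad(U)` of `M₂(J)`. -/
def twist : GHom J.mat2 J.mat2 where
  toHom := D.isIdealEmbedding_mat.conj D.rot D.rotInv D.rotInv_mul_rot
  equivariant g x := D.isIdealEmbedding_mat.injective <| by
    rw [IsIdealEmbedding.conj_apply, mat2Map_incl_act, mat2Map_incl_act,
      IsIdealEmbedding.conj_apply, map_mul, map_mul, matAct_rot, matAct_rotInv]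

theorem mat2Map_twist (x : Matrix (Fin 2) (Fin 2) J.carrier) :
    mat2Map D.incl (D.twist.toHom x) = D.rot * mat2Map D.incl x * D.rotInv :=
  D.isIdealEmbedding_mat.conj_apply _ _ D.rotInv_mul_rot x

/-- The automorphism `ad(U⁻¹)` of `M₂(J)`. -/
def untwist : Matrix (Fin 2) (Fin 2) J.carrier →ₙₐ[ℂ] Matrix (Fin 2) (Fin 2) J.carrier :=
  D.isIdealEmbedding_mat.conj D.rotInv D.rot D.rot_mul_rotInv

theorem mat2Map_untwist (x : Matrix (Fin 2) (Fin 2) J.carrier) :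
    mat2Map D.incl (D.untwist x) = D.rotInv * mat2Map D.incl x * D.rot :=
  D.isIdealEmbedding_mat.conj_apply _ _ D.rot_mul_rotInv x

theorem twist_untwist (x : Matrix (Fin 2) (Fin 2) J.carrier) :
    D.twist.toHom (D.untwist x) = x := D.isIdealEmbedding_mat.injective <| by
  rw [mat2Map_twist, mat2Map_untwist]
  calc D.rot * (D.rotInv * mat2Map D.incl x * D.rot) * D.rotInv
      = (D.rot * D.rotInv) * mat2Map D.incl x * (D.rot * D.rotInv) := by noncomm_ring
    _ = _ := by rw [rot_mul_rotInv, one_mul, mul_one]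

theorem untwist_twist (x : Matrix (Fin 2) (Fin 2) J.carrier) :
    D.untwist (D.twist.toHom x) = x := D.isIdealEmbedding_mat.injective <| by
  rw [mat2Map_untwist, mat2Map_twist]
  calc D.rotInv * (D.rot * mat2Map D.incl x * D.rotInv) * D.rot
      = (D.rotInv * D.rot) * mat2Map D.incl x * (D.rotInv * D.rot) := by noncomm_ring
    _ = _ := by rw [rotInv_mul_rot, one_mul, mul_one]

/-- The rotation is homotopic to the identity. -/
theorem mor_twist : D.twist.mor = CategoryTheory.CategoryStruct.id (GKObj.mk J.mat2) := by
  -- The rotation by the angle πt/2 is A₀ + cos(πt/2) A₁ + sin(πt/2) A₂ with constant G-invariant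
  -- matrices. The matrices B are those of the inverse rotation, where only the sine term changes
  -- sign.
  let r : Fin 3 → IntervalFun := ![1,
    (⟨fun t => (Real.cos (Real.pi / 2 * t) : ℂ), by fun_prop⟩ : C(unitInterval, ℂ)),
    (⟨fun t => (Real.sin (Real.pi / 2 * t) : ℂ), by fun_prop⟩ : C(unitInterval, ℂ))]
  let A : Fin 3 → Matrix (Fin 2) (Fin 2) (Unitization ℂ X.carrier) :=
    ![!![1 - D.proj, 0; 0, 1 - D.proj], !![D.proj, 0; 0, D.proj], !![0, D.proj; -D.proj, 0]]
  let B : Fin 3 → Matrix (Fin 2) (Fin 2) (Unitization ℂ X.carrier) :=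
    ![!![1 - D.proj, 0; 0, 1 - D.proj], !![D.proj, 0; 0, D.proj], !![0, -D.proj; D.proj, 0]]
  have hr : ∀ t : unitInterval, IntervalFun.eval t (r 0) = 1 ∧
      IntervalFun.eval t (r 1) = (Real.cos (Real.pi / 2 * t) : ℂ) ∧
      IntervalFun.eval t (r 2) = (Real.sin (Real.pi / 2 * t) : ℂ) := fun t => ⟨rfl, rfl, rfl⟩
  have hA : ∀ t : unitInterval, ∑ i, IntervalFun.eval t (r i) • A i
      = rotation D.proj (Real.pi / 2 * t) := by
    intro t
    rw [Fin.sum_univ_three, (hr t).1, (hr t).2.1, (hr t).2.2, rotation_eq]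
    simp [A, add_comm]
  have hB : ∀ t : unitInterval, ∑ i, IntervalFun.eval t (r i) • B i
      = rotation D.proj (-(Real.pi / 2 * t)) := by
    intro t
    rw [Fin.sum_univ_three, (hr t).1, (hr t).2.1, (hr t).2.2, rotation_eq]
    simp [B, add_comm]
  have h := conj_homotopy D.isIdealEmbedding_mat D.matAct D.mat2Map_incl_act A B
    (fun g i => by
      fin_cases i <;> simp only [A, matAct] <;>
        exact (mat2Map_fin_two _ _ _ _ _).trans
          (by simp only [act_compl, map_zero, map_neg, act_proj]; rfl))
    (fun g i => by
      fin_cases i <;> simp only [B, matAct] <;>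
        exact (mat2Map_fin_two _ _ _ _ _).trans
          (by simp only [act_compl, map_zero, map_neg, act_proj]; rfl))
    r (fun t => by
      rw [hA, hB]
      have := rotation_mul_neg D.proj_mul_proj (-(Real.pi / 2 * t))
      rwa [neg_neg] at this)
    (GHom.id J.mat2) D.twist
    (fun x => by
      rw [hA, hB]
      simp [rotation_zero, GHom.id])
    (fun x => by
      rw [hA, hB, mat2Map_twist]
      simp [rot, rotInv])
  rw [← h, GHom.mor_id]

end DoubleSplit

/-! ### The homomorphisms t_± in M₂(Y⁺), for Y between J and X -/

/-- An algebra between the ideal `J` and the algebra `X` of a double split exact sequence. -/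
structure Intermediate {A X J : GAlg.{v, u} G} (D : DoubleSplit A X J) (Y : GAlg.{v, u} G) where
  incl : GHom J Y
  hom : GHom Y X
  isIdealEmbedding : IsIdealEmbedding incl.toHom
  hom_injective : Function.Injective hom.toHom
  hom_incl : ∀ j, hom.toHom (incl.toHom j) = D.i.toHom j

/-- The algebra `X` itself. -/
def Intermediate.whole {A X J : GAlg.{v, u} G} (D : DoubleSplit A X J) : Intermediate D X where
  incl := D.i
  hom := GHom.id X
  isIdealEmbedding := D.isIdealEmbedding
  hom_injective := Function.injective_id
  hom_incl _ := rfl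

/-- The ideal `J`. -/
def Intermediate.ideal {A X J : GAlg.{v, u} G} (D : DoubleSplit A X J) : Intermediate D J where
  incl := GHom.id J
  hom := D.i
  isIdealEmbedding := ⟨Function.injective_id, fun x j => ⟨x * j, rfl⟩, fun x j => ⟨j * x, rfl⟩⟩
  hom_injective := D.i_injective
  hom_incl _ := rfl

namespace DoubleSplit

variable {X J : GAlg.{v, u} G} (D : DoubleSplit (scalars G) X J)

/-- The homomorphism `s₊ ⊕ q`. -/
def sPlusQ : (scalars.{v, u} G).carrier →ₙₐ[ℂ]
    Matrix (Fin 2) (Fin 2) (Unitization ℂ X.carrier) where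
  toFun l := !![Unitization.inr (D.sPlus l), 0; 0, ULift.down l • (1 - D.proj)]
  map_smul' c l := by
    ext1 a b
    fin_cases a <;> fin_cases b <;> simp [smul_smul]
  map_zero' := by
    ext1 a b
    fin_cases a <;> fin_cases b <;> simp
  map_add' l m := by
    ext1 a b
    fin_cases a <;> fin_cases b <;> simp [add_smul]
  map_mul' l m := by
    have h : ULift.down (l * m) • (1 - D.proj)
        = (ULift.down l • (1 - D.proj)) * (ULift.down m • (1 - D.proj)) := by
      rw [smul_mul_smul_comm, compl_mul_compl]; rfl
    rw [Matrix.mul_fin_two, h, map_mul, Unitization.inr_mul]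
    simp only [mul_zero, zero_mul, add_zero, zero_add]

/-- Since s₋ ⊕ q is λ(p ⊕ p^⊥), passing to s₊ ⊕ q changes only the upper left corner, by s₊ - s₋ in
J. -/
theorem exists_sPlusQ (l : (scalars.{v, u} G).carrier) : ∃ j, D.sPlusQ l =
    mat2Map D.incl (Matrix.single 0 0 j) + ULift.down l • !![D.proj, 0; 0, 1 - D.proj] := by
  obtain ⟨j, hj⟩ := D.sub_mem l
  refine ⟨j, ?_⟩
  have hl : D.sMinus.toHom l = ULift.down l • D.sMinus.toHom ⟨1⟩ := by
    rw [← map_smul]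
    congr 1
    exact ULift.ext _ _ (mul_one _).symm
  have h : D.sPlus l = D.i.toHom j + ULift.down l • D.sMinus.toHom ⟨1⟩ := by rw [hj, ← hl]; abel
  ext1 a b
  fin_cases a <;> fin_cases b <;>
    simp [sPlusQ, mat2Map_apply, incl_apply, h, proj]

/-- The homomorphism `t₊ = ad(U) (s₊ ⊕ q)`. -/
def tPlus : (scalars.{v, u} G).carrier →ₙₐ[ℂ]
    Matrix (Fin 2) (Fin 2) (Unitization ℂ X.carrier) where
  toFun l := D.rot * D.sPlusQ l * D.rotInv
  map_smul' c l := by simp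
  map_zero' := by simp
  map_add' l m := by simp [mul_add, add_mul]
  map_mul' l m := by
    rw [map_mul]
    calc D.rot * (D.sPlusQ l * D.sPlusQ m) * D.rotInv
        = D.rot * D.sPlusQ l * 1 * D.sPlusQ m * D.rotInv := by noncomm_ring
      _ = _ := by rw [← rotInv_mul_rot]; noncomm_ring

theorem tPlus_apply (l : (scalars.{v, u} G).carrier) :
    D.tPlus l = D.rot * D.sPlusQ l * D.rotInv := rfl

/-- Conjugation by U sends λ(p ⊕ p^⊥) to λ(0 ⊕ 1) and preserves M₂(J). Hence t₊ - t₋ lies in M₂(J),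
and t₊ has its values in M₂(J⁺) even where U has not its entries in J⁺. -/
theorem exists_tPlus (l : (scalars.{v, u} G).carrier) : ∃ j, D.tPlus l =
    mat2Map D.incl (D.twist.toHom (Matrix.single 0 0 j)) + !![0, 0; 0, ULift.down l • 1] := by
  obtain ⟨j, hj⟩ := D.exists_sPlusQ l
  refine ⟨j, ?_⟩
  rw [tPlus_apply, hj, mat2Map_twist, mul_add, add_mul, mul_smul_comm, smul_mul_assoc,
    rot_conj_diag]
  congr 1
  ext1 a b
  fin_cases a <;> fin_cases b <;> simp

end DoubleSplit

/-- The homomorphism `t₋ : λ ↦ λ (0 ⊕ 1)`. -/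
def tMinus (Y : GAlg.{v, u} G) : GHom (scalars G) Y.plus.mat2 where
  toHom :=
    { toFun := fun l => !![0, 0; 0, ULift.down l • 1]
      map_smul' := fun c l => by
        ext1 a b
        fin_cases a <;> fin_cases b <;> simp [smul_smul]
      map_zero' := by
        ext1 a b
        fin_cases a <;> fin_cases b <;> simp <;> rfl
      map_add' := fun l m => by
        ext1 a b
        fin_cases a <;> fin_cases b <;> simp [add_smul]
      map_mul' := fun l m => by
        rw [Matrix.mul_fin_two]
        ext1 a b
        fin_cases a <;> fin_cases b <;> simp [smul_smul, mul_comm] }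
  equivariant g l := by
    refine Eq.trans ?_ (mat2Map_fin_two _ _ _ _ _).symm
    rw [map_zero, map_smul, unitizationMap_one]
    rfl

theorem tMinus_apply (Y : GAlg.{v, u} G) (l : (scalars.{v, u} G).carrier) :
    (tMinus Y).toHom l = !![0, 0; 0, ULift.down l • 1] := rfl

namespace Intermediate

variable {X J Y : GAlg.{v, u} G} {D : DoubleSplit (scalars G) X J} (I : Intermediate D Y)

/-- The embedding `M₂(J) → M₂(Y⁺)`. -/
def matIncl : GHom J.mat2 Y.plus.mat2 where
  toHom := mat2Map ((Unitization.inrNonUnitalAlgHom ℂ Y.carrier).comp I.incl.toHom)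
  equivariant g x := by
    ext1 a b
    change Unitization.inr (I.incl.toHom (J.act.toFun g (x a b)))
      = unitizationMap (Y.act.toFun g) (Unitization.inr (I.incl.toHom (x a b)))
    rw [unitizationMap_inr, I.incl.equivariant]

/-- The embedding `M₂(Y⁺) → M₂(X⁺)`. -/
def matHom : Matrix (Fin 2) (Fin 2) (Unitization ℂ Y.carrier) →ₙₐ[ℂ]
    Matrix (Fin 2) (Fin 2) (Unitization ℂ X.carrier) :=
  mat2Map (unitizationMap I.hom.toHom)

theorem matHom_injective : Function.Injective I.matHom :=
  mat2Map_injective (unitizationMap_injective I.hom_injective)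

theorem matHom_matIncl (x : Matrix (Fin 2) (Fin 2) J.carrier) :
    I.matHom (I.matIncl.toHom x) = mat2Map D.incl x := by
  ext1 a b
  change unitizationMap I.hom.toHom (Unitization.inr (I.incl.toHom (x a b)))
    = Unitization.inr (D.i.toHom (x a b))
  rw [unitizationMap_inr, I.hom_incl]

theorem matHom_tMinus (l : (scalars.{v, u} G).carrier) :
    I.matHom ((tMinus Y).toHom l) = !![0, 0; 0, ULift.down l • 1] := by
  rw [tMinus_apply, matHom, mat2Map_fin_two, map_zero, map_smul, unitizationMap_one]

theorem matHom_act (g : G) (x : Matrix (Fin 2) (Fin 2) (Unitization ℂ Y.carrier)) :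
    I.matHom (Y.plus.mat2.act.toFun g x) = D.matAct g (I.matHom x) := by
  ext1 a b
  change unitizationMap I.hom.toHom (unitizationMap (Y.act.toFun g) (x a b))
    = unitizationMap (X.act.toFun g) (unitizationMap I.hom.toHom (x a b))
  rw [unitizationMap_apply _ (x a b), unitizationMap_apply _ (x a b)]
  simp [unitizationMap_apply, I.hom.equivariant]

/-- The homomorphism `t₊` with values in `M₂(Y⁺)`. -/
def tPlus : (scalars.{v, u} G).carrier →ₙₐ[ℂ] Matrix (Fin 2) (Fin 2) (Unitization ℂ Y.carrier) :=
  -- The conjugation by U is carried out in M₂(X⁺), and only its result is pulled back to M₂(Y⁺).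
  liftHom I.matHom I.matHom_injective D.tPlus fun l => by
    obtain ⟨j, hj⟩ := D.exists_tPlus l
    exact ⟨I.matIncl.toHom (D.twist.toHom (Matrix.single 0 0 j)) + (tMinus Y).toHom l, by
      rw [map_add, matHom_matIncl, matHom_tMinus, hj]⟩

theorem matHom_tPlus (l : (scalars.{v, u} G).carrier) : I.matHom (I.tPlus l) = D.tPlus l :=
  liftHom_apply _ _ _ _ l

/-- The rotated double split exact sequence. -/
def doubleSplit : DoubleSplit (scalars G) Y.plus.mat2 J.mat2 where
  i := I.matIncl
  i_injective := I.isIdealEmbedding.unitization.mat2.injective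
  mul_mem := I.isIdealEmbedding.unitization.mat2.mul_mem
  mem_mul := I.isIdealEmbedding.unitization.mat2.mem_mul
  sMinus := tMinus Y
  sPlus := I.tPlus
  sub_mem l := by
    obtain ⟨j, hj⟩ := D.exists_tPlus l
    refine ⟨D.twist.toHom (Matrix.single 0 0 j), I.matHom_injective ?_⟩
    rw [matHom_matIncl, map_sub, matHom_tPlus, matHom_tMinus, hj, add_sub_cancel_right]

end Intermediate

/-! ### The actions on the rotated algebra, and the comparison with the given morphism -/

namespace LevelOne

variable {B X J Y : GAlg.{v, u} G} (D : LevelOne (scalars G) B X J)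
  (I : Intermediate D.toDoubleSplit Y)

/-- The representation of the algebra `M` of the rotated double split exact sequence. -/
def rho : I.doubleSplit.M →ₙₐ[ℂ] Ambient J where
  -- Undoing the rotation lets diagonal matrices implement the actions. The component in ℂ is kept
  -- because X⁺ need not act faithfully on J.
  toFun m := (D.left.mapMatrix (D.rotInv * I.matHom m.1.1 * D.rot), I.doubleSplit.deg m)
  map_smul' c m := Prod.ext (by simp) (map_smul _ c m)
  map_zero' := Prod.ext (by simp) (map_zero _)
  map_add' m n := Prod.ext (by
    have h : D.rotInv * I.matHom (m + n).1.1 * D.rot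
        = D.rotInv * I.matHom m.1.1 * D.rot + D.rotInv * I.matHom n.1.1 * D.rot := by
      rw [← add_mul, ← mul_add, ← map_add]; rfl
    rw [h, map_add]; rfl) (map_add _ m n)
  map_mul' m n := Prod.ext (by
    have h : D.rotInv * I.matHom (m * n).1.1 * D.rot
        = (D.rotInv * I.matHom m.1.1 * D.rot) * (D.rotInv * I.matHom n.1.1 * D.rot) := by
      calc D.rotInv * I.matHom (m.1.1 * n.1.1) * D.rot
          = D.rotInv * I.matHom m.1.1 * 1 * I.matHom n.1.1 * D.rot := by
            rw [map_mul]; noncomm_ring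
        _ = _ := by rw [← D.rot_mul_rotInv]; noncomm_ring
    rw [h, map_mul]; rfl) (map_mul _ m n)

theorem rho_inclM (x : Matrix (Fin 2) (Fin 2) J.carrier) :
    D.rho I (I.doubleSplit.inclM x) = D.ambientElem (D.untwist x) 0 := by
  refine Prod.ext ?_ rfl
  change D.left.mapMatrix (D.rotInv * I.matHom (I.matIncl.toHom x) * D.rot) = _
  rw [I.matHom_matIncl, ← D.mat2Map_untwist, ambientElem, zero_smul, add_zero]

theorem rho_unitM : D.rho I I.doubleSplit.unitM = D.ambientElem 0 1 := by
  refine Prod.ext ?_ rfl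
  change D.left.mapMatrix (D.rotInv * I.matHom ((tMinus Y).toHom ⟨1⟩) * D.rot) = _
  have h : I.matHom ((tMinus Y).toHom ⟨1⟩) = D.rot * !![D.proj, 0; 0, 1 - D.proj] * D.rotInv := by
    rw [I.matHom_tMinus, D.rot_conj_diag, one_smul]
  rw [h, ambientElem, map_zero, zero_add, one_smul]
  congr 1
  calc D.rotInv * (D.rot * !![D.proj, 0; 0, 1 - D.proj] * D.rotInv) * D.rot
      = (D.rotInv * D.rot) * !![D.proj, 0; 0, 1 - D.proj] * (D.rotInv * D.rot) := by noncomm_ring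
    _ = _ := by rw [D.rotInv_mul_rot, one_mul, mul_one]

theorem ambientElem_eq (x : Matrix (Fin 2) (Fin 2) J.carrier) (l : ℂ) :
    D.ambientElem x l = D.ambientElem x 0 + l • D.ambientElem 0 1 := by
  refine Prod.ext ?_ ?_
  · simp only [ambientElem, Prod.fst_add, Prod.smul_fst, ← map_smul, ← map_add, zero_smul,
      add_zero, map_zero, zero_add, one_smul]
  · simp [ambientElem]

theorem exists_rho_eq (x : Matrix (Fin 2) (Fin 2) J.carrier) (l : ℂ) :
    ∃ m, D.rho I m = D.ambientElem x l :=
  ⟨I.doubleSplit.inclM (D.twist.toHom x) + l • I.doubleSplit.unitM, by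
    rw [map_add, map_smul, rho_inclM, rho_unitM, D.untwist_twist, ← ambientElem_eq]⟩

theorem exists_eq_rho (m : I.doubleSplit.M) :
    ∃ x, D.rho I m = D.ambientElem x (I.doubleSplit.deg m) := by
  obtain ⟨x, hx⟩ := I.doubleSplit.exists_eq_add m
  refine ⟨D.untwist x, ?_⟩
  conv_lhs => rw [hx]
  rw [map_add, map_smul, rho_inclM, rho_unitM, ← ambientElem_eq]

theorem eq_zero_of_ambientElem {x : Matrix (Fin 2) (Fin 2) J.carrier}
    (h : D.ambientElem x 0 = 0) : x = 0 := by
  ext a b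
  refine D.e_corner.eq_zero_of_mul_eq_zero fun y => ?_
  have h' := congrFun (congrFun (congrArg Prod.fst h) a) b
  have h'' : D.left (D.incl (x a b)) = 0 := by
    simpa [ambientElem, mat2Map_apply] using h'
  rw [← D.left_incl, h'', LinearMap.zero_apply]

/-- The component in ℂ forces an element of the kernel into M₂(J), where left multiplication is
faithful because J has trivial left annihilator. -/
theorem rho_injective : Function.Injective (D.rho I) := by
  rw [injective_iff_map_eq_zero]
  intro m hm
  obtain ⟨x, hx⟩ := I.doubleSplit.exists_eq_add m
  have hdeg : I.doubleSplit.deg m = 0 := congrArg Prod.snd hm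
  rw [hdeg, zero_smul, add_zero] at hx
  rw [hx, rho_inclM] at hm
  have h := D.eq_zero_of_ambientElem hm
  rw [hx, ← D.twist_untwist x, h, map_zero, map_zero]

/-- Testing against the idempotent of degree one shows that m lies in M₂(J); testing against
single-entry matrices reduces to the annihilator of J. This is the hypothesis of
`isCornerEmbedding_single`. -/
theorem eq_zero_of_mul_eq_zero {m : I.doubleSplit.M} (hm : ∀ n, m * n = 0) : m = 0 := by
  have hdeg : I.doubleSplit.deg m = 0 := by
    have := congrArg I.doubleSplit.deg (hm I.doubleSplit.unitM)
    rwa [map_mul, I.doubleSplit.deg_unitM, mul_one, map_zero] at this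
  obtain ⟨x, rfl⟩ := I.doubleSplit.exists_inclM hdeg
  suffices h : x = 0 by rw [h, map_zero]
  ext a b
  refine D.e_corner.eq_zero_of_mul_eq_zero fun y => ?_
  have h := hm (I.doubleSplit.inclM (Matrix.single b b y))
  rw [← map_mul] at h
  have h' := I.doubleSplit.inclM_injective (h.trans (map_zero _).symm)
  have h'' : (x * Matrix.single b b y) a b = 0 := congrFun (congrFun h' a) b
  simpa using h''

theorem exists_rho_conj (g : G) (a b : Fin 2) (m : I.doubleSplit.M) :
    ∃ n, D.rho I n = D.ambientRep a g * D.rho I m * D.ambientRep b g⁻¹ := by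
  obtain ⟨x, hx⟩ := D.exists_eq_rho I m
  obtain ⟨y, hy⟩ := D.exists_ambientElem_conj g a b x (I.doubleSplit.deg m)
  rw [hx, hy]
  exact D.exists_rho_eq I y _

/-- The action of `M₋` in the ambient algebra. -/
theorem rho_minusAct (g : G) (m : I.doubleSplit.M) :
    D.rho I (I.doubleSplit.minusAct.toFun g m)
      = D.ambientRep 0 g * D.rho I m * D.ambientRep 0 g⁻¹ := by
  -- Since `rep 0 g` is the action of g on J, covariance of left multiplication makes γ₋ inner in
  -- End(J). As U is G-invariant, undoing the rotation does not disturb this.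
  have hleft : ∀ x, D.left (unitizationMap (X.act.toFun g) x)
      = D.rep 0 g * D.left x * D.rep 0 g⁻¹ := fun x => by
    have h : D.left (unitizationMap (X.act.toFun g) x) * D.rep 0 g = D.rep 0 g * D.left x :=
      LinearMap.ext fun j => by
        simp only [Module.End.mul_apply, rep_zero]
        exact D.left_act g x j
    rw [← h, mul_assoc, rep_mul_inv, mul_one]
  refine Prod.ext ?_ ?_
  · change D.left.mapMatrix (D.rotInv * I.matHom (Y.plus.mat2.act.toFun g m.1.1) * D.rot)
      = !![D.rep 0 g, 0; 0, D.char g 0 0 • D.rep 0 g]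
        * D.left.mapMatrix (D.rotInv * I.matHom m.1.1 * D.rot)
        * !![D.rep 0 g⁻¹, 0; 0, D.char g⁻¹ 0 0 • D.rep 0 g⁻¹]
    rw [I.matHom_act, char_diag, char_diag, one_smul, one_smul]
    have h : D.rotInv * D.matAct g (I.matHom m.1.1) * D.rot
        = D.matAct g (D.rotInv * I.matHom m.1.1 * D.rot) := by
      rw [map_mul, map_mul, D.matAct_rot, D.matAct_rotInv]
    rw [h]
    generalize D.rotInv * I.matHom m.1.1 * D.rot = z
    have hz : D.left.mapMatrix z
        = !![D.left (z 0 0), D.left (z 0 1); D.left (z 1 0), D.left (z 1 1)] := by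
      ext1 a b
      fin_cases a <;> fin_cases b <;> rfl
    have hgz : D.left.mapMatrix (D.matAct g z)
        = !![D.rep 0 g * D.left (z 0 0) * D.rep 0 g⁻¹, D.rep 0 g * D.left (z 0 1) * D.rep 0 g⁻¹;
          D.rep 0 g * D.left (z 1 0) * D.rep 0 g⁻¹, D.rep 0 g * D.left (z 1 1) * D.rep 0 g⁻¹] := by
      simp only [← hleft]
      ext1 a b
      fin_cases a <;> fin_cases b <;> rfl
    rw [hz, hgz, Matrix.mul_fin_two, Matrix.mul_fin_two]
    simp only [zero_mul, mul_zero, add_zero, zero_add]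
  · change I.doubleSplit.deg m = D.char g 0 0 * I.doubleSplit.deg m * D.char g⁻¹ 0 0
    rw [char_diag, char_diag, one_mul, mul_one]

/-- The homomorphism `x ⊕ λ ↦ (x ⊕ λ p^⊥) ⊕ λ` in the ambient algebra. -/
def ambientHom : D.M →ₙₐ[ℂ] Ambient J where
  toFun m := (!![D.leftM m, 0; 0, D.deg m • (1 - D.left D.proj)], D.deg m)
  map_smul' c m := by
    refine Prod.ext ?_ (map_smul _ c m)
    ext1 a b
    fin_cases a <;> fin_cases b <;> simp [DoubleSplit.leftM, smul_smul]
  map_zero' := by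
    refine Prod.ext ?_ (map_zero _)
    ext1 a b
    fin_cases a <;> fin_cases b <;> simp [DoubleSplit.leftM]
  map_add' m n := by
    refine Prod.ext ?_ (map_add _ m n)
    ext1 a b
    fin_cases a <;> fin_cases b <;> simp [DoubleSplit.leftM, add_smul]
  map_mul' m n := by
    refine Prod.ext ?_ (map_mul _ m n)
    have h : (1 - D.left D.proj) * (1 - D.left D.proj) = 1 - D.left D.proj := by
      rw [← map_one D.left, ← map_sub, ← map_mul, D.compl_mul_compl]
    rw [Prod.fst_mul, Matrix.mul_fin_two]
    ext1 a b
    fin_cases a <;> fin_cases b <;> simp [DoubleSplit.leftM, smul_smul, h, mul_comm]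

theorem ambientHom_apply (m : D.M) : D.ambientHom m
    = (!![D.leftM m, 0; 0, D.deg m • (1 - D.left D.proj)], D.deg m) := rfl

theorem ambientHom_inclM (j : J.carrier) :
    D.ambientHom (D.inclM j) = D.ambientElem (Matrix.single 0 0 j) 0 := by
  refine Prod.ext ?_ rfl
  rw [ambientElem_fst, ambientHom_apply, D.leftM_inclM, D.deg_inclM]
  simp

theorem ambientHom_unitM : D.ambientHom D.unitM = D.ambientElem 0 1 := by
  refine Prod.ext ?_ rfl
  rw [ambientElem_fst, ambientHom_apply, D.leftM_unitM, D.deg_unitM]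
  simp

/-- The elements that define the new actions also implement every entry of the old M₂-action.
Compatibility of `rotate` with the actions of M₋, M₊ and M₂(M) follows from this one formula. -/
theorem ambientHom_entry (g : G) (a b : Fin 2) (m : D.M) :
    D.ambientHom (D.δ.entry g a b m)
      = D.ambientRep a g * D.ambientHom m * D.ambientRep b g⁻¹ := by
  have hunit : D.δ.entry g 0 0 D.unitM = D.unitM := by
    rw [entry_zero]
    exact (D.splitExact.s.equivariant g ⟨1⟩).symm
  have hp : D.rep 0 g * (1 - D.left D.proj) * D.rep 0 g⁻¹ = 1 - D.left D.proj := by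
    rw [mul_sub, sub_mul, mul_one, rep_mul_inv, ← D.leftM_unitM, rep_mul_leftM, hunit]
  have hc : D.char g⁻¹ b 0 * (D.deg m * D.char g a 0) = D.deg (D.δ.entry g a b m) := by
    rw [deg_entry, ← D.char_mul_char_inv g a b]; ring
  have hc' : D.char g a 0 * D.deg m * D.char g⁻¹ b 0 = D.deg (D.δ.entry g a b m) := by
    rw [← hc]; ring
  have hS : ∀ c k, D.ambientRep c k
      = (!![D.rep c k, 0; 0, D.char k c 0 • D.rep 0 k], D.char k c 0) := fun _ _ => rfl
  rw [ambientHom_apply, ambientHom_apply, hS, hS, Prod.mk_mul_mk, Prod.mk_mul_mk,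
    Matrix.mul_fin_two, Matrix.mul_fin_two]
  simp only [zero_mul, mul_zero, add_zero, zero_add, mul_smul_comm, smul_mul_assoc, rep_mul_leftM,
    hp, smul_smul, smul_zero]
  rw [hc, hc']

/-- The morphism from the given to the rotated double split exact sequence. -/
def rotate : D.M →ₙₐ[ℂ] I.doubleSplit.M :=
  liftHom (D.rho I) (D.rho_injective I) D.ambientHom fun m => by
    obtain ⟨j, hj⟩ := D.exists_eq_add m
    rw [hj, map_add, map_smul, ambientHom_inclM, ambientHom_unitM, ← ambientElem_eq]
    exact D.exists_rho_eq I _ _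

theorem rho_rotate (m : D.M) : D.rho I (D.rotate I m) = D.ambientHom m :=
  liftHom_apply _ _ _ _ m

theorem rotate_sPlusM (l : (scalars.{v, u} G).carrier) :
    D.rotate I (D.sPlusM l) = I.doubleSplit.sPlusM l := D.rho_injective I <| by
  rw [rho_rotate]
  refine Prod.ext ?_ rfl
  change _ = D.left.mapMatrix (D.rotInv * I.matHom (I.tPlus l) * D.rot)
  -- In the representation the rotation is undone, so t₊ appears there as s₊ ⊕ q.
  have h : D.rotInv * I.matHom (I.tPlus l) * D.rot = D.sPlusQ l := by
    rw [I.matHom_tPlus, D.tPlus_apply]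
    calc D.rotInv * (D.rot * D.sPlusQ l * D.rotInv) * D.rot
        = (D.rotInv * D.rot) * D.sPlusQ l * (D.rotInv * D.rot) := by noncomm_ring
      _ = _ := by rw [D.rotInv_mul_rot, one_mul, mul_one]
  rw [h, ambientHom_apply]
  ext1 a b
  fin_cases a <;> fin_cases b <;> simp [DoubleSplit.sPlusQ] <;> rfl

theorem rotate_sMinusM (l : (scalars.{v, u} G).carrier) :
    D.rotate I (D.sMinusM l) = I.doubleSplit.sMinusM l := D.rho_injective I <| by
  obtain ⟨l⟩ := l
  rw [rho_rotate, D.sMinusM_eq, I.doubleSplit.sMinusM_eq, map_smul, map_smul, rho_unitM,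
    ambientHom_unitM]

theorem rotate_inclM (j : J.carrier) : D.rotate I (D.inclM j)
    = I.doubleSplit.inclM (D.twist.toHom (Matrix.single 0 0 j)) := D.rho_injective I <| by
  rw [rho_rotate, ambientHom_inclM, rho_inclM, D.untwist_twist]

/-- The representation, that implements the `M₂`-action. -/
def ambientRep₂ : G →* Matrix (Fin 2) (Fin 2) (Ambient J) where
  toFun g := Matrix.diagonal fun a => D.ambientRep a g
  map_one' := by simp
  map_mul' g h := by simp

/-- The second action on the algebra `M` of the rotated sequence. -/
def rotatedPlusAct : GAction G I.doubleSplit.M :=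
  conjAct (D.rho I) (D.rho_injective I) (D.ambientRep 1) fun g m => D.exists_rho_conj I g 1 1 m

theorem rho_rotatedPlusAct (g : G) (m : I.doubleSplit.M) :
    D.rho I ((D.rotatedPlusAct I).toFun g m)
      = D.ambientRep 1 g * D.rho I m * D.ambientRep 1 g⁻¹ :=
  conjAct_apply _ _ _ _ g m

/-- The `M₂`-action of the rotated sequence. -/
def rotatedδ : GAction G (Matrix (Fin 2) (Fin 2) I.doubleSplit.M) :=
  conjAct (mat2Map (D.rho I)) (mat2Map_injective (D.rho_injective I)) D.ambientRep₂ fun g m => by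
    choose n hn using fun a b => D.exists_rho_conj I g a b (m a b)
    refine ⟨n, ?_⟩
    ext1 a b
    refine (hn a b).trans ?_
    simp [ambientRep₂, mat2Map_apply]

theorem rho_rotatedδ (g : G) (m : Matrix (Fin 2) (Fin 2) I.doubleSplit.M) (a b : Fin 2) :
    D.rho I ((D.rotatedδ I).toFun g m a b)
      = D.ambientRep a g * D.rho I (m a b) * D.ambientRep b g⁻¹ := by
  refine (congrFun (congrFun (conjAct_apply (mat2Map (D.rho I)) _ D.ambientRep₂ _ g m) a) b).trans ?_
  simp [ambientRep₂, mat2Map_apply]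

theorem rotatedδ_single (g : G) (k : Fin 2) {m n : I.doubleSplit.M}
    (h : D.rho I n = D.ambientRep k g * D.rho I m * D.ambientRep k g⁻¹) :
    (D.rotatedδ I).toFun g (Matrix.single k k m) = Matrix.single k k n := by
  ext1 a b
  refine D.rho_injective I ?_
  rw [rho_rotatedδ, Matrix.single_apply, Matrix.single_apply]
  split_ifs with hab
  · rw [← hab.1, ← hab.2, h]
  · simp

theorem isDiagonal_rotatedδ : (D.rotatedδ I).IsDiagonal := fun g k m => by
  obtain ⟨n, hn⟩ := D.exists_rho_conj I g k k m
  exact ⟨n, D.rotatedδ_single I g k hn⟩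

/-- The inclusion into a corner as an algebra homomorphism. -/
def singleHom (A : Type u) [NonUnitalRing A] [Module ℂ A] (k : Fin 2) :
    A →ₙₐ[ℂ] Matrix (Fin 2) (Fin 2) A where
  toFun := Matrix.single k k
  map_smul' c x := (Matrix.smul_single c k k x).symm
  map_zero' := Matrix.single_zero k k
  map_add' := Matrix.single_add k k
  map_mul' x y := (Matrix.single_mul_single_same x k k k y).symm

theorem rotate_minusAct (g : G) (m : D.M) : D.rotate I (D.minusAct.toFun g m)
    = I.doubleSplit.minusAct.toFun g (D.rotate I m) := D.rho_injective I <| by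
  rw [rho_minusAct, rho_rotate, rho_rotate, ← entry_zero, ambientHom_entry]

theorem rotate_plusAct (g : G) (m : D.M) : D.rotate I (D.plusAct.toFun g m)
    = (D.rotatedPlusAct I).toFun g (D.rotate I m) := D.rho_injective I <| by
  rw [rho_rotatedPlusAct, rho_rotate, rho_rotate, ← entry_one, ambientHom_entry]

theorem mat2Map_rotate_δ (g : G) (m : Matrix (Fin 2) (Fin 2) D.M) :
    mat2Map (D.rotate I) (D.δ.toFun g m) = (D.rotatedδ I).toFun g (mat2Map (D.rotate I) m) := by
  ext1 a b
  refine D.rho_injective I ?_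
  rw [rho_rotatedδ, mat2Map_apply, mat2Map_apply, rho_rotate, rho_rotate,
    D.isDiagonal_δ.apply D.quadratik_M, ambientHom_entry]

/-- The level-one morphism `t₊ ∇ t₋`. -/
def rotated : LevelOne (scalars G) B Y.plus.mat2 J.mat2 where
  toDoubleSplit := I.doubleSplit
  e := D.e.trans J.corner
  e_corner := isCornerEmbedding_trans_corner D.e_corner
  plusAct := D.rotatedPlusAct I
  projM_plusAct g m := by
    have h := congrArg Prod.snd (D.rho_rotatedPlusAct I g m)
    refine ULift.ext _ _ (h.trans ?_)
    change D.char g 1 0 * I.doubleSplit.deg m * D.char g⁻¹ 1 0 = I.doubleSplit.deg m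
    -- The scalars from the two sides of the conjugation combine to `char g 1 1`, which is 1.
    rw [mul_right_comm, char_mul_char_inv, char_diag, one_mul]
  plusAct_sPlusM g l := D.rho_injective I <| by
    -- Equivariance is inherited from s₊ ⊕ id, whose image under `rotate` is t₊ ⊕ id.
    rw [rho_rotatedPlusAct, ← D.rotate_sPlusM I l, rho_rotate, ← ambientHom_entry, entry_one,
      ← D.plusAct_sPlusM]
    exact (congrArg _ (D.rotate_sPlusM I _).symm).trans (D.rho_rotate I _)
  δ := D.rotatedδ I
  f₁ := ⟨singleHom _ 0, fun g m => (D.rotatedδ_single I g 0 (D.rho_minusAct I g m)).symm⟩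
  f₁_apply _ := rfl
  f₁_corner := isCornerEmbedding_single I.doubleSplit.Mminus (D.rotatedδ I)
    (D.isDiagonal_rotatedδ I) (fun _ h => D.eq_zero_of_mul_eq_zero I h) zero_ne_one _ fun _ => rfl
  f₂ := ⟨singleHom _ 1, fun g m => (D.rotatedδ_single I g 1 (D.rho_rotatedPlusAct I g m)).symm⟩
  f₂_apply _ := rfl
  f₂_corner := isCornerEmbedding_single
    ⟨I.doubleSplit.M, D.rotatedPlusAct I, I.doubleSplit.quadratik_M⟩ (D.rotatedδ I)
    (D.isDiagonal_rotatedδ I) (fun _ h => D.eq_zero_of_mul_eq_zero I h) one_ne_zero _ fun _ => rfl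

/-- On the ideals, `rotate` is the corner inclusion followed by ad(U). As ad(U) is the identity in
GK^G, the unrotated corner embedding b ↦ e(b) ⊕ 0 fits. -/
theorem toGK_rotated : (D.rotated I).toGK = D.toGK := by
  refine (LevelOne.toGK_eq D (D.rotated I) (J.corner.trans D.twist) (D.rotate I)
    (D.rotate_inclM I) (D.rotate_sMinusM I) (D.rotate_sPlusM I) (D.rotate_minusAct I)
    (D.rotate_plusAct I) (D.mat2Map_rotate_δ I) ?_).symm
  have h : (J.corner.trans D.twist).mor = J.corner.mor := by
    rw [GHom.mor_trans, D.mor_twist, CategoryTheory.Category.comp_id]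
  rw [h]
  exact (GHom.mor_trans _ _).symm

end LevelOne

/-! ### Explicit formulas for t_± -/

theorem unitizationMap_id (A : Type u) [NonUnitalRing A] [Module ℂ A] [IsScalarTower ℂ A A]
    [SMulCommClass ℂ A A] (x : Unitization ℂ A) :
    unitizationMap (NonUnitalAlgHom.id ℂ A) x = x := by
  rw [unitizationMap_apply, NonUnitalAlgHom.coe_id, id, Unitization.inl_fst_add_inr_snd_eq]

namespace DoubleSplit

variable {X J : GAlg.{v, u} G} (D : DoubleSplit (scalars G) X J)

theorem isUnit_rot : IsUnit D.rot :=
  ⟨⟨D.rot, D.rotInv, D.rot_mul_rotInv, D.rotInv_mul_rot⟩, rfl⟩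

theorem ad_rot (x : Matrix (Fin 2) (Fin 2) (Unitization ℂ X.carrier)) :
    ad D.rot x = D.rot * x * D.rotInv := by
  have h : Ring.inverse D.rot = D.rotInv :=
    Ring.inverse_unit ⟨D.rot, D.rotInv, D.rot_mul_rotInv, D.rotInv_mul_rot⟩
  rw [ad, h]

theorem ad_rot_sMinus (l : ℂ) :
    ad D.rot !![Unitization.inr (D.sMinus.toHom ⟨l⟩), 0; 0, l • (1 - D.proj)]
      = !![0, 0; 0, l • 1] := by
  have hl : D.sMinus.toHom ⟨l⟩ = l • D.sMinus.toHom ⟨1⟩ := by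
    rw [← map_smul]
    congr 1
    exact ULift.ext _ _ (mul_one _).symm
  have h : (!![Unitization.inr (D.sMinus.toHom ⟨l⟩), 0; 0, l • (1 - D.proj)] :
      Matrix (Fin 2) (Fin 2) (Unitization ℂ X.carrier))
      = l • !![D.proj, 0; 0, 1 - D.proj] := by
    rw [hl, Unitization.inr_smul]
    ext1 a b
    fin_cases a <;> fin_cases b <;> simp [proj]
  rw [h, ad_rot, mul_smul_comm, smul_mul_assoc, rot_conj_diag]
  ext1 a b
  fin_cases a <;> fin_cases b <;> simp

theorem tPlus_eq (l : ℂ) : D.tPlus ⟨l⟩ =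
    !![(1 - D.proj) * Unitization.inr (D.sPlus ⟨l⟩) * (1 - D.proj),
      -((1 - D.proj) * Unitization.inr (D.sPlus ⟨l⟩) * D.proj);
      -(D.proj * Unitization.inr (D.sPlus ⟨l⟩) * (1 - D.proj)),
      D.proj * Unitization.inr (D.sPlus ⟨l⟩) * D.proj + l • (1 - D.proj)] := by
  change D.rot * !![Unitization.inr (D.sPlus ⟨l⟩), 0; 0, l • (1 - D.proj)] * D.rotInv = _
  rw [rot_eq, rotInv_eq, Matrix.mul_fin_two, Matrix.mul_fin_two]
  simp only [mul_zero, add_zero, zero_add, mul_smul_comm, smul_mul_assoc, proj_mul_compl,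
    compl_mul_proj, compl_mul_compl, smul_zero, zero_mul, mul_neg, neg_mul, neg_neg]

end DoubleSplit

end GKTheory

end
open GKTheory in
theorem proposition2p2 {G : Type v} [Group G] {B X J : GAlg.{v, u} G}
    (D : LevelOne (scalars G) B X J) :
    -- `s₋(λ)` and `s₊(λ)` in `X⁺`
    let sm : ℂ → Unitization ℂ X.carrier := fun l => Unitization.inr (D.sMinus.toHom ⟨l⟩)
    let sp : ℂ → Unitization ℂ X.carrier := fun l => Unitization.inr (D.sPlus ⟨l⟩)
    let p : Unitization ℂ X.carrier := sm 1
    let p' : Unitization ℂ X.carrier := 1 - p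
    let q : ℂ → Unitization ℂ X.carrier := fun l => l • p'
    let U : Matrix (Fin 2) (Fin 2) (Unitization ℂ X.carrier) := rotation p (Real.pi / 2)
    let tm : ℂ → Matrix (Fin 2) (Fin 2) (Unitization ℂ X.carrier) :=
      fun l => !![0, 0; 0, l • 1]
    let tp : ℂ → Matrix (Fin 2) (Fin 2) (Unitization ℂ X.carrier) :=
      fun l => !![p' * sp l * p', -(p' * sp l * p); -(p * sp l * p'), p * sp l * p + q l]
    -- `t₋ = ad(U) (s₋ ⊕ q)` and `t₊ = ad(U) (s₊ ⊕ q)`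
    IsUnit U ∧
    (∀ l, ad U !![sm l, 0; 0, q l] = tm l) ∧
    (∀ l, ad U !![sp l, 0; 0, q l] = tp l) ∧
    -- the level-one morphism into `M₂(X⁺)`
    (∃ T : LevelOne (scalars G) B X.plus.mat2 J.mat2,
      (∀ j, T.i.toHom j = j.map fun x => Unitization.inr (D.i.toHom x)) ∧
      (∀ b, T.e.toHom b = Matrix.single 0 0 (D.e.toHom b)) ∧
      (∀ l, T.sMinus.toHom ⟨l⟩ = tm l) ∧
      (∀ l, T.sPlus ⟨l⟩ = tp l) ∧
      T.toGK = D.toGK) ∧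
    -- the same with `X⁺` replaced by `J⁺`
    (∃ T : LevelOne (scalars G) B J.plus.mat2 J.mat2,
      (∀ j, T.i.toHom j = j.map fun x => Unitization.inr x) ∧
      (∀ b, T.e.toHom b = Matrix.single 0 0 (D.e.toHom b)) ∧
      (∀ l, (T.sMinus.toHom ⟨l⟩).map (unitizationMap D.i.toHom) = tm l) ∧
      (∀ l, (T.sPlus ⟨l⟩).map (unitizationMap D.i.toHom) = tp l) ∧
      T.toGK = D.toGK) := by
  refine ⟨D.isUnit_rot, D.ad_rot_sMinus, fun l => (D.ad_rot _).trans (D.tPlus_eq l),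
    ⟨D.rotated (Intermediate.whole D.toDoubleSplit), fun j => rfl, fun b => rfl, fun l => rfl,
      fun l => ?_, D.toGK_rotated _⟩,
    ⟨D.rotated (Intermediate.ideal D.toDoubleSplit), fun j => rfl, fun b => rfl,
      fun l => (Intermediate.ideal D.toDoubleSplit).matHom_tMinus ⟨l⟩,
      fun l => ((Intermediate.ideal D.toDoubleSplit).matHom_tPlus ⟨l⟩).trans (D.tPlus_eq l),
      D.toGK_rotated _⟩⟩
  -- For Y = X the map of M₂(Y⁺) into M₂(X⁺) is induced by the unitization of the identity, which
  -- has to be rewritten to the identity entry by entry.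
  refine Eq.trans ?_ (((Intermediate.whole D.toDoubleSplit).matHom_tPlus ⟨l⟩).trans (D.tPlus_eq l))
  ext1 a b
  exact (unitizationMap_id X.carrier _).symm
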